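/- Let $u_0:[0,1]\to\mathbb R$ and $j:(0,\infty)\to\mathbb R$, and let $u$ be a classical solution of $$u_t=u_{xx}\ (0<x<1,\ t>0),\qquad u(x,0)=u_0(x)\ (0\le x\le 1),\qquad u(0,t)=0,\quad u_x(1,t)-u(1,t)=j(t)\ (t>0);$$ that is, $u$ is continuous on $[0,1]\times[0,\infty)$, $u_t,u_{xx}$ exist and are continuous on $(0,1)\times(0,\infty)$, and $u_x$ exists and is continuous on $(0,1]\times(0,\infty)$ (one-sided derivative at $x=1$). No compatibility between $u_0$ and $j$ at the corner $(1,0)$ is assumed. Put $$\hat u_0(\lambda)=\int_0^1 e^{\lambda y}u_0(y)\,dy,\qquad \hat u(\lambda,T)=\int_0^1 e^{\lambda y}u(y,T)\,dy,\qquad \hat j(\lambda,t)=\int_0^t e^{\lambda\tau}j(\tau)\,d\tau,$$ $$h(\lambda)=e^{-i\lambda}(1+i\lambda),\qquad \Delta(\lambda)=h(\lambda)-h(-\lambda)=e^{-i\lambda}(1+i\lambda)-e^{i\lambda}(1-i\lambda),$$ $$\mu_0(\lambda)=(i\lambda+1)e^{-i\lambda}\hat u_0(i\lambda)+(i\lambda-1)e^{i\lambda}\hat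 u_0(-i\lambda)+2i\lambda\,\hat j(\lambda^2,t),\qquad \mu_1(\lambda)=\mu_0(\lambda)-\Delta(\lambda)\hat u_0(-i\lambda),$$ and, for $\varepsilon>0$, $$D_+=\{\lambda+i\varepsilon:\tfrac{\pi}{4}\le\arg\lambda\le\tfrac{3\pi}{4}\},\qquad D_-=\{\lambda-i\varepsilon:\tfrac{5\pi}{4}\le\arg\lambda\le\tfrac{7\pi}{4}\},$$ with boundaries $\partial D_\pm$ positively oriented (the domain lies on the left). Let $0<x<1$ and $t>0$, let $j$ be integrable on $(0,t)$, and let $\varepsilon>0$ be so small that $2\varepsilon t<\min(x,1-x)$. Then $\Delta$ has no zeros off the real axis, the following three integrals converge absolutely, and $$u(x,t)=\frac1{2\pi}\left\{\int_{-\infty}^{\infty}e^{i\lambda x-\lambda^2t}\,\hat u_0(-i\lambda)\,d\lambda-\int_{\partial D_+}\frac{e^{i\lambda x-\lambda^2t}}{\Delta(\lambda)}\,\mu_0(\lambda)\,d\lambda-\int_{\partial D_-}\frac{e^{i\lambda x-\lambda^2t}}{\Delta(\lambda)}\,\mu_1(\lambda)\,d\lambda\right\}.$$ Moreover the data on a future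 time slice do not contribute: for every $T\ge t$, with $$\nu_0^+(\lambda)=-\bigl(h(\lambda)\hat u(i\lambda,T)-h(-\lambda)\hat u(-i\lambda,T)\bigr)e^{\lambda^2T},\qquad \nu_1^+(\lambda)=-\bigl(\hat u(i\lambda,T)-\hat u(-i\lambda,T)\bigr)e^{\lambda^2T},$$ the integrals $$\int_{\partial D_+}\frac{e^{i\lambda x-\lambda^2t}}{\Delta(\lambda)}\,\nu_0^+(\lambda)\,d\lambda,\qquad \int_{\partial D_-}\frac{e^{i\lambda x-\lambda^2t}}{\Delta(\lambda)}\,h(\lambda)\,\nu_1^+(\lambda)\,d\lambda$$ converge absolutely and vanish. -/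

import Mathlib

open MeasureTheory Set

namespace RobinHeat

noncomputable section

/-- `u` (with arguments `x`, `t`) is a classical solution of
`u_t = u_xx` for `0 < x < 1`, `t > 0`, with `u(x,0) = u₀(x)` for `0 ≤ x ≤ 1`, and
`u(0,t) = 0`, `u_x(1,t) - u(1,t) = j(t)` for `t > 0`.
It is continuous up to the boundary (including `t = 0`), `u_t` and hence `u_xx` are continuous in
the interior, and `u_x` is continuous up to the side `x = 1`, `t > 0`, where it is the one-sided
derivative. No compatibility of `j` with `u₀` at the corner `x = 1`, `t = 0` is required. -/
structure IsClassicalSolution (u₀ j : ℝ → ℝ) (u : ℝ → ℝ → ℝ) : Prop where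
  continuousOn : ContinuousOn (fun p : ℝ × ℝ => u p.1 p.2) (Icc 0 1 ×ˢ Ici 0)
  differentiable_t : ∀ x ∈ Ioo (0 : ℝ) 1, ∀ t > 0, DifferentiableAt ℝ (fun s => u x s) t
  continuousOn_t :
    ContinuousOn (fun p : ℝ × ℝ => deriv (fun s => u p.1 s) p.2) (Ioo 0 1 ×ˢ Ioi 0)
  differentiable_x : ∀ x ∈ Ioc (0 : ℝ) 1, ∀ t > 0,
    DifferentiableWithinAt ℝ (fun y => u y t) (Icc 0 1) x
  continuousOn_x :
    ContinuousOn (fun p : ℝ × ℝ => derivWithin (fun y => u y p.2) (Icc 0 1) p.1)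
      (Ioc 0 1 ×ˢ Ioi 0)
  heat : ∀ x ∈ Ioo (0 : ℝ) 1, ∀ t > 0,
    HasDerivAt (fun y => deriv (fun y' => u y' t) y) (deriv (fun s => u x s) t) x
  initial : ∀ x ∈ Icc (0 : ℝ) 1, u x 0 = u₀ x
  dirichlet : ∀ t > 0, u 0 t = 0
  robin : ∀ t > 0, derivWithin (fun y => u y t) (Icc 0 1) 1 - u 1 t = j t

/-- `f̂(k) = ∫₀¹ e^{k x} f(x) dx`. -/
def spaceTransform (f : ℝ → ℝ) (k : ℂ) : ℂ :=
  ∫ x in (0 : ℝ)..1, Complex.exp (k * x) * (f x : ℂ)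

/-- `ĵ(k, T) = ∫₀ᵀ e^{k τ} j(τ) dτ`. -/
def timeTransform (j : ℝ → ℝ) (k : ℂ) (T : ℝ) : ℂ :=
  ∫ τ in (0 : ℝ)..T, Complex.exp (k * τ) * (j τ : ℂ)

/-- `h(k) = e^{-ik} (1 + ik)`. -/
def h (k : ℂ) : ℂ := Complex.exp (-Complex.I * k) * (1 + Complex.I * k)

/-- `Δ(k) = e^{-ik} (1 + ik) - e^{ik} (1 - ik)`. -/
def Δ (k : ℂ) : ℂ :=
  Complex.exp (-Complex.I * k) * (1 + Complex.I * k)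
    - Complex.exp (Complex.I * k) * (1 - Complex.I * k)

/-- `μ₀(k) = (ik + 1) e^{-ik} û₀(ik) + (ik - 1) e^{ik} û₀(-ik) + 2ik ĵ(k², t)`. -/
def μ₀ (u₀ j : ℝ → ℝ) (t : ℝ) (k : ℂ) : ℂ :=
  (Complex.I * k + 1) * Complex.exp (-Complex.I * k) * spaceTransform u₀ (Complex.I * k)
    + (Complex.I * k - 1) * Complex.exp (Complex.I * k) * spaceTransform u₀ (-Complex.I * k)
    + 2 * Complex.I * k * timeTransform j (k ^ 2) t

/-- `μ₁(k) = μ₀(k) - Δ(k) û₀(-ik)`. -/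
def μ₁ (u₀ j : ℝ → ℝ) (t : ℝ) (k : ℂ) : ℂ :=
  μ₀ u₀ j t k - Δ k * spaceTransform u₀ (-Complex.I * k)

/-- Contribution of the time slice `T` to `Δ(k) ∫₀ᵀ e^{k² s} u_x(0,s) ds`. -/
def ν₀Future (u : ℝ → ℝ → ℝ) (T : ℝ) (k : ℂ) : ℂ :=
  -(h k * spaceTransform (fun x => u x T) (Complex.I * k)
    - h (-k) * spaceTransform (fun x => u x T) (-Complex.I * k)) * Complex.exp (k ^ 2 * T)

/-- Contribution of the time slice `T` to `Δ(k) ∫₀ᵀ e^{k² s} u_x(1,s) ds`. -/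
def ν₁Future (u : ℝ → ℝ → ℝ) (T : ℝ) (k : ℂ) : ℂ :=
  -(spaceTransform (fun x => u x T) (Complex.I * k)
    - spaceTransform (fun x => u x T) (-Complex.I * k)) * Complex.exp (k ^ 2 * T)

/-- The elementary solution `e^{ikx - k²t}` of the heat equation. -/
def elem (x t : ℝ) (k : ℂ) : ℂ := Complex.exp (Complex.I * k * x - k ^ 2 * t)

/-- The integrand, with respect to `r > 0`, of the integral of `f` over the ray
`{p + r e^{iθ}}`, oriented away from its vertex `p`. -/
def rayIntegrand (p : ℂ) (θ : ℝ) (f : ℂ → ℂ) (r : ℝ) : ℂ :=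
  f (p + r * Complex.exp (Complex.I * θ)) * Complex.exp (Complex.I * θ)

/-- Absolute convergence of the integral of `f` over a ray. -/
def RayIntegrable (p : ℂ) (θ : ℝ) (f : ℂ → ℂ) : Prop :=
  IntegrableOn (rayIntegrand p θ f) (Ioi 0)

/-- The integral of `f` over a ray. -/
def rayIntegral (p : ℂ) (θ : ℝ) (f : ℂ → ℂ) : ℂ :=
  ∫ r in Ioi (0 : ℝ), rayIntegrand p θ f r

/-- Absolute convergence of the integral of `f` over `∂D₊`,
`D₊ = {iε + k : π/4 ≤ arg k ≤ 3π/4}`. -/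
def IntegrableBoundaryPlus (ε : ℝ) (f : ℂ → ℂ) : Prop :=
  RayIntegrable (Complex.I * ε) (Real.pi / 4) f ∧ RayIntegrable (Complex.I * ε) (3 * Real.pi / 4) f

/-- The integral over the positively oriented `∂D₊`, `D₊ = {iε + k : π/4 ≤ arg k ≤ 3π/4}`:
in along the ray of angle `3π/4`, out along the ray of angle `π/4`. -/
def integralBoundaryPlus (ε : ℝ) (f : ℂ → ℂ) : ℂ :=
  rayIntegral (Complex.I * ε) (Real.pi / 4) f - rayIntegral (Complex.I * ε) (3 * Real.pi / 4) f

/-- Absolute convergence of the integral of `f` over `∂D₋`,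
`D₋ = {-iε + k : 5π/4 ≤ arg k ≤ 7π/4}`. -/
def IntegrableBoundaryMinus (ε : ℝ) (f : ℂ → ℂ) : Prop :=
  RayIntegrable (-Complex.I * ε) (5 * Real.pi / 4) f ∧
    RayIntegrable (-Complex.I * ε) (7 * Real.pi / 4) f

/-- The integral over the positively oriented `∂D₋`, `D₋ = {-iε + k : 5π/4 ≤ arg k ≤ 7π/4}`:
in along the ray of angle `7π/4`, out along the ray of angle `5π/4`. -/
def integralBoundaryMinus (ε : ℝ) (f : ℂ → ℂ) : ℂ :=
  rayIntegral (-Complex.I * ε) (5 * Real.pi / 4) f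
    - rayIntegral (-Complex.I * ε) (7 * Real.pi / 4) f

end

end RobinHeat

open Filter Topology
open Complex (I)

/-!
Let `L(k) = ∫₀ᵗ e^{k²s} u_x(0, s) ds` and `R(k) = ∫₀ᵗ e^{k²s} (u_x - i k u)(1, s) ds` be the
transforms of the two boundary fluxes, with `u_x(1, ·)` replaced by `j + u(1, ·)`. Integrating the
heat equation against `e^{-iky + k²s}` gives
`e^{k²t} û(-ik, t) = û₀(-ik) - L(k) + e^{-ik} R(-k)`. Both fluxes are entire, and `L` is even, so
that `Δ(k) L(k) = h(k) L(k) - h(-k) L(-k)`; in this combination the unknown transform of `u(1, ·)`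
cancels, which leaves `μ₀ + ν₀⁺`, with the time slice `t` entering only through `ν₀⁺`.

Fourier inversion at time `t` has no integrable integrand, so it is regularised by an additional
heat flow over a time `s`, and `s → 0⁺` at the end. For `s > 0` the contour of each flux term is
moved from the real line to `∂D₊` (after the reflection `k ↦ -k`, which exchanges `D₊` and `D₋`,
for the term at `x = 1`), where `2εt < min(x, 1 - x)` gives bounds uniform in `s`. Dividing by `Δ`,
which has only real zeros, is then harmless; the terms `ν` contain `e^{k²(T - t)}`, which is bounded
on `D₊` for `T ≥ t`, and vanish by closing the contour there.
-/

namespace RobinHeat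

section StripShift

variable {E : Type*} [NormedAddCommGroup E] [NormedSpace ℂ E]

theorem integral_rect_eq {f : ℂ → E} {a b : ℝ} (hab : a ≤ b)
    (hf : ∀ z : ℂ, z.im ∈ Icc a b → DifferentiableAt ℂ f z) (n : ℝ) :
    ((∫ x in -n..n, f (x + a * I)) - ∫ x in -n..n, f (x + b * I)) =
      I • (∫ y in a..b, f ((-n : ℝ) + y * I)) - I • ∫ y in a..b, f (n + y * I) := by
  have h := Complex.integral_boundary_rect_eq_zero_of_differentiableOn f
    ((-n : ℝ) + a * I) ((n : ℝ) + b * I) fun z hz => by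
      have him : z.im ∈ Icc a b := by simpa [uIcc_of_le hab] using hz.2
      exact (hf z him).differentiableWithinAt
  simp only [Complex.add_re, Complex.ofReal_re, Complex.re_ofReal_mul, Complex.I_re, mul_zero,
    add_zero, Complex.add_im, Complex.ofReal_im, Complex.im_ofReal_mul, Complex.I_im, mul_one,
    zero_add] at h
  rw [← sub_eq_zero, ← h]
  abel

theorem tendsto_integral_vertical_zero {f : ℂ → E} {B : ℝ → ℝ} {a b : ℝ} (hab : a ≤ b)
    (hfB : ∀ x : ℝ, ∀ y ∈ Icc a b, ‖f (x + y * I)‖ ≤ B x) {l : Filter ℝ}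
    (hB : Tendsto B l (𝓝 0)) : Tendsto (fun x : ℝ => ∫ y in a..b, f (x + y * I)) l (𝓝 0) := by
  refine squeeze_zero_norm (fun x => intervalIntegral.norm_integral_le_of_norm_le_const
    fun y hy => hfB x y ?_) (by simpa using hB.mul_const |b - a|)
  rw [uIoc_of_le hab] at hy
  exact Ioc_subset_Icc_self hy

theorem integrable_horizontal {f : ℂ → E} {B : ℝ → ℝ} {a b : ℝ}
    (hf : ∀ z : ℂ, z.im ∈ Icc a b → DifferentiableAt ℂ f z) (hB : Integrable B)
    (hfB : ∀ x : ℝ, ∀ y ∈ Icc a b, ‖f (x + y * I)‖ ≤ B x) {y : ℝ} (hy : y ∈ Icc a b) :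
    Integrable fun x : ℝ => f (x + y * I) := by
  have hcont : Continuous fun x : ℝ => f (x + y * I) :=
    continuous_iff_continuousAt.2 fun x =>
      ContinuousAt.comp (f := fun x : ℝ => (x : ℂ) + y * I)
        (hf _ (by simpa using hy)).continuousAt (by fun_prop)
  exact hB.mono' hcont.aestronglyMeasurable (.of_forall fun x => hfB x y hy)

theorem integral_horizontal_eq {f : ℂ → E} {B : ℝ → ℝ} {a b : ℝ} (hab : a ≤ b)
    (hf : ∀ z : ℂ, z.im ∈ Icc a b → DifferentiableAt ℂ f z) (hB : Integrable B)
    (hB_bot : Tendsto B atBot (𝓝 0)) (hB_top : Tendsto B atTop (𝓝 0))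
    (hfB : ∀ x : ℝ, ∀ y ∈ Icc a b, ‖f (x + y * I)‖ ≤ B x) :
    ∫ x : ℝ, f (x + a * I) = ∫ x : ℝ, f (x + b * I) := by
  have hside : ∀ y ∈ Icc a b, Tendsto (fun n : ℝ => ∫ x in -n..n, f (x + y * I)) atTop
      (𝓝 (∫ x : ℝ, f (x + y * I))) := fun y hy =>
    intervalIntegral_tendsto_integral (integrable_horizontal hf hB hfB hy)
      tendsto_neg_atTop_atBot tendsto_id
  have hleft := (tendsto_integral_vertical_zero hab hfB hB_bot).comp tendsto_neg_atTop_atBot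
  have hright := tendsto_integral_vertical_zero hab hfB hB_top
  have hzero := (hleft.const_smul I).sub (hright.const_smul I)
  rw [smul_zero, sub_zero] at hzero
  have hdiff := (hside a (left_mem_Icc.2 hab)).sub (hside b (right_mem_Icc.2 hab))
  exact sub_eq_zero.1 <| tendsto_nhds_unique hdiff <|
    hzero.congr fun n => (integral_rect_eq hab hf n).symm

end StripShift

section Rays

variable {p : ℂ} {θ C c : ℝ} {f : ℂ → ℂ}

theorem norm_rayIntegrand (p : ℂ) (θ : ℝ) (f : ℂ → ℂ) (r : ℝ) :
    ‖rayIntegrand p θ f r‖ = ‖f (p + r * Complex.exp (I * θ))‖ := by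
  rw [rayIntegrand, norm_mul, Complex.norm_exp_I_mul_ofReal, mul_one]

theorem continuousOn_rayIntegrand
    (hf : ∀ r : ℝ, 0 < r → ContinuousAt f (p + r * Complex.exp (I * θ))) :
    ContinuousOn (rayIntegrand p θ f) (Ioi 0) := fun r hr =>
  ((ContinuousAt.comp (f := fun r : ℝ => p + r * Complex.exp (I * θ)) (hf r hr)
    (by fun_prop)).mul continuousAt_const).continuousWithinAt

theorem rayIntegrable_of_decay (hc : 0 < c)
    (hf : ∀ r : ℝ, 0 < r → ContinuousAt f (p + r * Complex.exp (I * θ)))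
    (hb : ∀ r : ℝ, 0 < r → ‖f (p + r * Complex.exp (I * θ))‖ ≤ C * Real.exp (-c * r)) :
    RayIntegrable p θ f :=
  ((exp_neg_integrableOn_Ioi 0 hc).const_mul C).mono'
    ((continuousOn_rayIntegrand hf).aestronglyMeasurable measurableSet_Ioi)
    (ae_restrict_of_forall_mem measurableSet_Ioi fun r hr =>
      (norm_rayIntegrand p θ f r).trans_le (hb r hr))

theorem cexp_add_mul_I (x θ : ℝ) :
    Complex.exp (x + θ * I) = Real.exp x * Complex.exp (I * θ) := by
  rw [Complex.exp_add, Complex.ofReal_exp, mul_comm I]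

theorem integral_Ioi_eq_integral_comp_exp {E : Type*} [NormedAddCommGroup E] [NormedSpace ℝ E]
    (g : ℝ → E) : ∫ r in Ioi 0, g r = ∫ x, Real.exp x • g (Real.exp x) := by
  simpa [Real.range_exp, image_univ] using integral_image_eq_integral_abs_deriv_smul
    MeasurableSet.univ (fun x _ => (Real.hasDerivAt_exp x).hasDerivWithinAt)
    Real.exp_injective.injOn g

theorem integrableOn_Ioi_iff_integrable_comp_exp {E : Type*} [NormedAddCommGroup E]
    [NormedSpace ℝ E] (g : ℝ → E) :
    IntegrableOn g (Ioi 0) ↔ Integrable fun x => Real.exp x • g (Real.exp x) := by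
  simpa [Real.range_exp, image_univ] using integrableOn_image_iff_integrableOn_abs_deriv_smul
    MeasurableSet.univ (fun x _ => (Real.hasDerivAt_exp x).hasDerivWithinAt)
    Real.exp_injective.injOn g

theorem rayIntegral_eq_integral_comp_exp (p : ℂ) (θ : ℝ) (f : ℂ → ℂ) :
    rayIntegral p θ f =
      ∫ x : ℝ, f (p + Complex.exp (x + θ * I)) * Complex.exp (x + θ * I) := by
  rw [rayIntegral, integral_Ioi_eq_integral_comp_exp]
  refine integral_congr_ae (.of_forall fun x => ?_)
  simp only [rayIntegrand, cexp_add_mul_I, Complex.real_smul]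
  ring

theorem tendsto_mul_exp_neg_mul_atTop (hc : 0 < c) :
    Tendsto (fun r : ℝ => r * Real.exp (-c * r)) atTop (𝓝 0) := by
  simpa using tendsto_rpow_mul_exp_neg_mul_atTop_nhds_zero 1 c hc

/-- In the logarithmic parameter `w` given by `k = p + exp w`, the sector between two rays becomes
a strip. -/
theorem rayIntegral_eq_of_decay {a b : ℝ} (hab : a ≤ b) (hc : 0 < c)
    (hf : ∀ θ ∈ Icc a b, ∀ r : ℝ, 0 < r → DifferentiableAt ℂ f (p + r * Complex.exp (I * θ)))
    (hb : ∀ θ ∈ Icc a b, ∀ r : ℝ, 0 < r →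
      ‖f (p + r * Complex.exp (I * θ))‖ ≤ C * Real.exp (-c * r)) :
    rayIntegral p a f = rayIntegral p b f := by
  simp only [rayIntegral_eq_integral_comp_exp]
  set g : ℝ → ℝ := fun r => C * Real.exp (-c * r)
  have hg_top : Tendsto (fun r => r * g r) atTop (𝓝 0) := by
    simpa [g, mul_left_comm] using (tendsto_mul_exp_neg_mul_atTop hc).const_mul C
  have hg_zero : Tendsto (fun r => r * g r) (𝓝 0) (𝓝 0) := by
    have hcont : Continuous fun r => r * g r := by fun_prop
    simpa using hcont.tendsto 0
  refine integral_horizontal_eq (f := fun w => f (p + Complex.exp w) * Complex.exp w)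
    (B := fun x => Real.exp x * g (Real.exp x)) hab (fun w hw => ?_)
    ((integrableOn_Ioi_iff_integrable_comp_exp g).1
      ((exp_neg_integrableOn_Ioi 0 hc).const_mul C))
    (hg_zero.comp Real.tendsto_exp_atBot) (hg_top.comp Real.tendsto_exp_atTop) fun x θ hθ => ?_
  · have hfw := hf w.im hw (Real.exp w.re) (Real.exp_pos _)
    rw [← cexp_add_mul_I, Complex.re_add_im] at hfw
    exact (hfw.comp w (by fun_prop)).mul Complex.differentiableAt_exp
  · rw [norm_mul, Complex.norm_exp, cexp_add_mul_I]
    simpa [g, mul_comm] using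
      mul_le_mul_of_nonneg_right (hb θ hθ _ (Real.exp_pos x)) (Real.exp_pos x).le

theorem integral_horizontal_eq_rayIntegral_sub {ε : ℝ}
    (hf : Integrable fun x : ℝ => f (x + ε * I)) :
    ∫ x : ℝ, f (x + ε * I) = rayIntegral (I * ε) 0 f - rayIntegral (I * ε) Real.pi f := by
  have hright : rayIntegral (I * ε) 0 f = ∫ x in Ioi (0 : ℝ), f (x + ε * I) := by
    simp [rayIntegral, rayIntegrand, add_comm, mul_comm I]
  have hleft : rayIntegral (I * ε) Real.pi f = -∫ x in Iic (0 : ℝ), f (x + ε * I) := by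
    rw [← neg_zero, ← integral_comp_neg_Ioi (c := 0) (fun x : ℝ => f (x + ε * I))]
    simp [rayIntegral, rayIntegrand, integral_neg, add_comm, mul_comm I]
  rw [hright, hleft, ← intervalIntegral.integral_Iic_add_Ioi hf.integrableOn hf.integrableOn]
  ring

theorem rayIntegrand_neg_add_pi (p : ℂ) (θ : ℝ) (f : ℂ → ℂ) :
    rayIntegrand (-p) (θ + Real.pi) f = -rayIntegrand p θ fun k => f (-k) := by
  have hexp : Complex.exp (I * (θ + Real.pi : ℝ)) = -Complex.exp (I * θ) := by
    rw [Complex.ofReal_add, mul_add, Complex.exp_add, mul_comm I (Real.pi : ℂ),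
      Complex.exp_pi_mul_I, mul_neg_one]
  ext r
  simp only [rayIntegrand, hexp, Pi.neg_apply, mul_neg, neg_add]

theorem rayIntegral_neg_add_pi (p : ℂ) (θ : ℝ) (f : ℂ → ℂ) :
    rayIntegral (-p) (θ + Real.pi) f = -rayIntegral p θ fun k => f (-k) := by
  simp [rayIntegral, rayIntegrand_neg_add_pi, integral_neg]

theorem rayIntegrable_neg_add_pi {p : ℂ} {θ : ℝ} {f : ℂ → ℂ} :
    RayIntegrable (-p) (θ + Real.pi) f ↔ RayIntegrable p θ fun k => f (-k) := by
  simp only [RayIntegrable, IntegrableOn, rayIntegrand_neg_add_pi, integrable_neg_iff]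

theorem integralBoundaryMinus_eq (ε : ℝ) (f : ℂ → ℂ) :
    integralBoundaryMinus ε f = -integralBoundaryPlus ε fun k => f (-k) := by
  rw [integralBoundaryMinus, show 5 * Real.pi / 4 = Real.pi / 4 + Real.pi by ring,
    show 7 * Real.pi / 4 = 3 * Real.pi / 4 + Real.pi by ring, neg_mul, rayIntegral_neg_add_pi,
    rayIntegral_neg_add_pi, integralBoundaryPlus, neg_sub_neg, neg_sub]

theorem integrableBoundaryMinus_iff {ε : ℝ} {f : ℂ → ℂ} :
    IntegrableBoundaryMinus ε f ↔ IntegrableBoundaryPlus ε fun k => f (-k) := by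
  rw [IntegrableBoundaryMinus, show 5 * Real.pi / 4 = Real.pi / 4 + Real.pi by ring,
    show 7 * Real.pi / 4 = 3 * Real.pi / 4 + Real.pi by ring, neg_mul, rayIntegrable_neg_add_pi,
    rayIntegrable_neg_add_pi, IntegrableBoundaryPlus]

end Rays

section Geometry

variable {θ : ℝ}

theorem sq_re (k : ℂ) : (k ^ 2).re = k.re ^ 2 - k.im ^ 2 := by
  rw [sq, Complex.mul_re, ← sq, ← sq]

theorem ray_re (ε r θ : ℝ) : (I * ε + r * Complex.exp (I * θ)).re = r * Real.cos θ := by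
  simp [mul_comm I, Complex.exp_ofReal_mul_I_re]

theorem ray_im (ε r θ : ℝ) : (I * ε + r * Complex.exp (I * θ)).im = ε + r * Real.sin θ := by
  simp [mul_comm I, Complex.exp_ofReal_mul_I_im]

theorem norm_ray_le {ε r : ℝ} (hε : 0 ≤ ε) (hr : 0 ≤ r) (θ : ℝ) :
    ‖I * ε + r * Complex.exp (I * θ)‖ ≤ ε + r := by
  refine (norm_add_le _ _).trans_eq ?_
  simp [Complex.norm_exp_I_mul_ofReal, abs_of_nonneg, hε, hr]

theorem sin_le_abs_cos_of_le (h₀ : 0 ≤ θ) (h₁ : θ ≤ Real.pi / 4) :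
    Real.sin θ ≤ |Real.cos θ| := by
  refine le_trans ?_ (le_abs_self _)
  rw [← Real.cos_pi_div_two_sub]
  exact Real.cos_le_cos_of_nonneg_of_le_pi h₀ (by linarith) (by linarith)

theorem sin_le_abs_cos_of_ge (h₀ : 3 * Real.pi / 4 ≤ θ) (h₁ : θ ≤ Real.pi) :
    Real.sin θ ≤ |Real.cos θ| := by
  simpa using sin_le_abs_cos_of_le (θ := Real.pi - θ) (by linarith) (by linarith)

theorem abs_cos_le_sin (h₀ : Real.pi / 4 ≤ θ) (h₁ : θ ≤ 3 * Real.pi / 4) :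
    |Real.cos θ| ≤ Real.sin θ := by
  have hcos_two : Real.cos (2 * θ) ≤ 0 :=
    Real.cos_nonpos_of_pi_div_two_le_of_le (by linarith) (by linarith)
  rw [Real.cos_two_mul'] at hcos_two
  exact abs_le_of_sq_le_sq (by linarith)
    (Real.sin_nonneg_of_nonneg_of_le_pi (by linarith [Real.pi_pos]) (by linarith [Real.pi_pos]))

theorem half_le_sin_of_abs_cos_le (h : |Real.cos θ| ≤ Real.sin θ) : 1 / 2 ≤ Real.sin θ := by
  nlinarith [Real.sin_sq_add_cos_sq θ, sq_abs (Real.cos θ), abs_nonneg (Real.cos θ)]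

theorem half_le_abs_cos_of_sin_le (h₀ : 0 ≤ Real.sin θ) (h : Real.sin θ ≤ |Real.cos θ|) :
    1 / 2 ≤ |Real.cos θ| := by
  nlinarith [Real.sin_sq_add_cos_sq θ, sq_abs (Real.cos θ)]

end Geometry

section HeatExponential

variable {X t s s₀ ε c C : ℝ} {P : ℂ → ℂ}

theorem norm_elem (X σ : ℝ) (k : ℂ) :
    ‖elem X σ k‖ = Real.exp (-X * k.im - σ * (k ^ 2).re) := by
  rw [elem, Complex.norm_exp]
  congr 1
  simp only [Complex.sub_re, Complex.re_mul_ofReal, Complex.I_mul_re]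
  ring

theorem differentiable_elem (X σ : ℝ) : Differentiable ℂ (elem X σ) := by
  unfold elem; fun_prop

theorem add_le_mul_exp {A δ r : ℝ} (hA : 0 ≤ A) (hδ : 0 < δ) (hr : 0 ≤ r) :
    A + r ≤ (A + 1 / δ) * Real.exp (δ * r) := by
  have hexp := Real.add_one_le_exp (δ * r)
  have hδr : 0 ≤ δ * r := by positivity
  calc A + r ≤ (A + 1 / δ) * (δ * r + 1) := by
        field_simp
        nlinarith [mul_nonneg hA hδr, mul_nonneg (mul_nonneg hA hδr) hδ.le]
    _ ≤ (A + 1 / δ) * Real.exp (δ * r) := by gcongr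

/-- Growth in the closed upper half-plane of a transform `∫₀ᵗ e^{k²τ} g(τ) dτ` with coefficients
of at most linear growth. -/
def HasFluxGrowth (t C : ℝ) (P : ℂ → ℂ) : Prop :=
  ∀ k : ℂ, 0 ≤ k.im → ‖P k‖ ≤ C * ((1 + ‖k‖) * (1 + Real.exp (t * (k ^ 2).re)))

namespace HasFluxGrowth

theorem const_nonneg (hP : HasFluxGrowth t C P) : 0 ≤ C := by
  have h := (norm_nonneg _).trans (hP 0 (by simp))
  exact nonneg_of_mul_nonneg_left h (by positivity)

theorem norm_elem_mul_le (hP : HasFluxGrowth t C P) {k : ℂ} (hk : 0 ≤ k.im) {E : ℝ}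
    (h₁ : -X * k.im - (t + s) * (k ^ 2).re ≤ E) (h₂ : -X * k.im - s * (k ^ 2).re ≤ E) :
    ‖elem X (t + s) k * P k‖ ≤ 2 * C * (1 + ‖k‖) * Real.exp E := by
  have hC := hP.const_nonneg
  calc ‖elem X (t + s) k * P k‖
      ≤ Real.exp (-X * k.im - (t + s) * (k ^ 2).re) *
          (C * ((1 + ‖k‖) * (1 + Real.exp (t * (k ^ 2).re)))) := by
        rw [norm_mul, norm_elem]
        gcongr
        exact hP k hk
    _ = C * (1 + ‖k‖) * (Real.exp (-X * k.im - (t + s) * (k ^ 2).re) +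
          Real.exp (-X * k.im - s * (k ^ 2).re)) := by
        rw [show -X * k.im - s * (k ^ 2).re
          = (-X * k.im - (t + s) * (k ^ 2).re) + t * (k ^ 2).re by ring, Real.exp_add]
        ring
    _ ≤ C * (1 + ‖k‖) * (Real.exp E + Real.exp E) := by gcongr
    _ = 2 * C * (1 + ‖k‖) * Real.exp E := by ring

theorem norm_elem_mul_le_of_strip (hP : HasFluxGrowth t C P) (ht : 0 ≤ t) (hs : 0 < s)
    (hX : 0 ≤ X) (a : ℝ) {b : ℝ} (hb : b ∈ Icc 0 ε) :
    ‖elem X (t + s) (a + b * I) * P (a + b * I)‖ ≤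
      2 * C * (2 + ε + 2 / s) * Real.exp ((t + s) * ε ^ 2) * Real.exp (-(s / 2) * a ^ 2) := by
  have hC := hP.const_nonneg
  have hε : 0 ≤ ε := hb.1.trans hb.2
  have hre : ((a + b * I : ℂ) ^ 2).re = a ^ 2 - b ^ 2 := by simp [sq_re]
  have him : (a + b * I : ℂ).im = b := by simp
  have hexponent : ∀ σ, s ≤ σ → σ ≤ t + s →
      -X * b - σ * (a ^ 2 - b ^ 2) ≤ (t + s) * ε ^ 2 - s * a ^ 2 := fun σ hsσ hσ => by
    have hb2 : σ * b ^ 2 ≤ (t + s) * ε ^ 2 := by gcongr; exacts [hb.1, hb.2]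
    nlinarith [mul_nonneg hX hb.1, mul_le_mul_of_nonneg_right hsσ (sq_nonneg a)]
  have hlinear : 1 + ‖(a + b * I : ℂ)‖ ≤ (2 + ε + 2 / s) * Real.exp (s / 2 * a ^ 2) := by
    have hnorm : ‖(a + b * I : ℂ)‖ ≤ |a| + ε := by
      refine (norm_add_le _ _).trans ?_
      simpa [abs_of_nonneg hb.1] using hb.2
    have habsorb := add_le_mul_exp (A := 2 + ε) (by positivity) (half_pos hs) (sq_nonneg a)
    rw [one_div_div] at habsorb
    nlinarith [sq_abs a, sq_nonneg (|a| - 1)]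
  calc ‖elem X (t + s) (a + b * I) * P (a + b * I)‖
      ≤ 2 * C * (1 + ‖(a + b * I : ℂ)‖) * Real.exp ((t + s) * ε ^ 2 - s * a ^ 2) :=
        hP.norm_elem_mul_le (by rw [him]; exact hb.1)
          (by rw [him, hre]; exact hexponent _ (by linarith) le_rfl)
          (by rw [him, hre]; exact hexponent _ le_rfl (by linarith))
    _ ≤ 2 * C * ((2 + ε + 2 / s) * Real.exp (s / 2 * a ^ 2)) *
          Real.exp ((t + s) * ε ^ 2 - s * a ^ 2) := by gcongr
    _ = _ := by
        rw [show (t + s) * ε ^ 2 - s * a ^ 2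
          = (t + s) * ε ^ 2 + -(s / 2) * a ^ 2 - s / 2 * a ^ 2 by ring, Real.exp_sub, Real.exp_add]
        field_simp

/-- On the ray `iε + r e^{iθ}` the factor `e^{-σk²}`, `σ ≤ t + s₀`, costs at most
`e^{(t + s₀)(ε² + 2εr sin θ)}`, and `X` exceeds `2ε(t + s₀)` by the margin `c`. On the boundary of
the sector the remaining inequality `hK` holds with `K = 0`; inside it `K` depends on `s`. -/
theorem norm_elem_mul_le_of_sector (hP : HasFluxGrowth t C P) (ht : 0 ≤ t) (hε : 0 < ε)
    (hc : 0 < c) (hs : 0 ≤ s) (hs₀ : s ≤ s₀) (hX : 2 * ε * (t + s₀) + c ≤ X) {θ r K : ℝ}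
    (hr : 0 ≤ r) (hsin : 0 ≤ Real.sin θ) (hcos : Real.sin θ ≤ |Real.cos θ|)
    (hK : c * (r * |Real.cos θ| - r * Real.sin θ) ≤
      K + s * ((r * Real.cos θ) ^ 2 - (r * Real.sin θ) ^ 2)) :
    ‖elem X (t + s) (I * ε + r * Complex.exp (I * θ)) * P (I * ε + r * Complex.exp (I * θ))‖ ≤
      2 * C * (1 + ε + 4 / c) * Real.exp ((t + s₀) * ε ^ 2 + K) * Real.exp (-(c / 4) * r) := by
  have hC := hP.const_nonneg
  have hb : 0 ≤ r * Real.sin θ := mul_nonneg hr hsin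
  have hab : (r * Real.sin θ) ^ 2 ≤ (r * Real.cos θ) ^ 2 := by
    rw [mul_pow, mul_pow]; gcongr 1; exact sq_le_sq.2 (by rwa [abs_of_nonneg hsin])
  have hhalf : c * (r * (1 / 2)) ≤ c * (r * |Real.cos θ|) := by
    gcongr; exact half_le_abs_cos_of_sin_le hsin hcos
  have hexponent : ∀ σ, s ≤ σ → σ ≤ t + s₀ →
      -X * (ε + r * Real.sin θ) - σ * ((r * Real.cos θ) ^ 2 - (ε + r * Real.sin θ) ^ 2) ≤
        (t + s₀) * ε ^ 2 + K - c / 2 * r := fun σ hsσ hσ => by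
    generalize r * Real.sin θ = b at *
    have hXb := mul_le_mul_of_nonneg_right hX (by positivity : 0 ≤ ε + b)
    nlinarith [mul_nonneg (sub_nonneg.2 hsσ) (sub_nonneg.2 hab),
      mul_nonneg (sub_nonneg.2 hσ) (by positivity : 0 ≤ ε ^ 2 + 2 * ε * b),
      mul_nonneg hc.le hε.le, mul_nonneg (by linarith : 0 ≤ t + s₀) (sq_nonneg ε)]
  have hlinear : 1 + ‖I * ε + r * Complex.exp (I * θ)‖ ≤
      (1 + ε + 4 / c) * Real.exp (c / 4 * r) := by
    have habsorb := add_le_mul_exp (A := 1 + ε) (by positivity) (by positivity : 0 < c / 4) hr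
    rw [one_div_div] at habsorb
    linarith [norm_ray_le hε.le hr θ]
  calc _ ≤ 2 * C * (1 + ‖I * ε + r * Complex.exp (I * θ)‖) *
          Real.exp ((t + s₀) * ε ^ 2 + K - c / 2 * r) :=
        hP.norm_elem_mul_le (by rw [ray_im]; positivity)
          (by rw [sq_re, ray_re, ray_im]; exact hexponent _ (by linarith) (by linarith))
          (by rw [sq_re, ray_re, ray_im]; exact hexponent _ le_rfl (by linarith))
    _ ≤ 2 * C * ((1 + ε + 4 / c) * Real.exp (c / 4 * r)) *
          Real.exp ((t + s₀) * ε ^ 2 + K - c / 2 * r) := by gcongr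
    _ = _ := by
        rw [show (t + s₀) * ε ^ 2 + K - c / 2 * r
          = (t + s₀) * ε ^ 2 + K + -(c / 4) * r - c / 4 * r by ring, Real.exp_sub, Real.exp_add _
            (-(c / 4) * r)]
        field_simp

end HasFluxGrowth
end HeatExponential

section Deformation

variable {X t s s₀ ε c C : ℝ} {P : ℂ → ℂ}

theorem abs_cos_pi_div_four_eq_sin :
    |Real.cos (Real.pi / 4)| = Real.sin (Real.pi / 4) :=
  (abs_cos_le_sin le_rfl (by linarith [Real.pi_pos])).antisymm
    (sin_le_abs_cos_of_le (by linarith [Real.pi_pos]) le_rfl)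

theorem abs_cos_three_pi_div_four_eq_sin :
    |Real.cos (3 * Real.pi / 4)| = Real.sin (3 * Real.pi / 4) :=
  (abs_cos_le_sin (by linarith [Real.pi_pos]) le_rfl).antisymm
    (sin_le_abs_cos_of_ge le_rfl (by linarith [Real.pi_pos]))

theorem mul_sub_le_add_mul_sq_sub_sq {α β : ℝ} (hβ : 0 ≤ β) (hαβ : β ≤ α) (hs : 0 < s) :
    c * (α - β) ≤ c ^ 2 / (4 * s) + s * (α ^ 2 - β ^ 2) := by
  have hsquare : 0 ≤ (2 * s * (α - β) - c) ^ 2 / (4 * s) := by positivity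
  have hexpand : (2 * s * (α - β) - c) ^ 2 / (4 * s)
      = s * (α - β) ^ 2 + c ^ 2 / (4 * s) - c * (α - β) := by field_simp; ring
  nlinarith [mul_nonneg hs.le (mul_nonneg hβ (sub_nonneg.2 hαβ))]

theorem exists_regularization_margin (hε : 0 < ε) (hX : 2 * ε * t < X) :
    ∃ s₀ c : ℝ, 0 < s₀ ∧ 0 < c ∧ 2 * ε * (t + s₀) + c ≤ X := by
  have hgap : 0 < X - 2 * ε * t := sub_pos.2 hX
  refine ⟨(X - 2 * ε * t) / (4 * ε), (X - 2 * ε * t) / 2, div_pos hgap (by positivity),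
    half_pos hgap, ?_⟩
  field_simp
  linarith

theorem differentiable_elem_mul (hPd : Differentiable ℂ P) (X σ : ℝ) :
    Differentiable ℂ fun k => elem X σ k * P k :=
  (differentiable_elem X σ).mul hPd

namespace HasFluxGrowth

theorem norm_elem_mul_le_of_boundary (hP : HasFluxGrowth t C P) (ht : 0 ≤ t) (hε : 0 < ε)
    (hc : 0 < c) (hX : 2 * ε * (t + s₀) + c ≤ X) (hs : s ∈ Icc 0 s₀) {θ : ℝ}
    (hθ : |Real.cos θ| = Real.sin θ) {r : ℝ} (hr : 0 ≤ r) :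
    ‖elem X (t + s) (I * ε + r * Complex.exp (I * θ)) * P (I * ε + r * Complex.exp (I * θ))‖ ≤
      2 * C * (1 + ε + 4 / c) * Real.exp ((t + s₀) * ε ^ 2) * Real.exp (-(c / 4) * r) := by
  have h := hP.norm_elem_mul_le_of_sector (K := 0) ht hε hc hs.1 hs.2 hX hr
    (hθ ▸ abs_nonneg _) hθ.ge (by simp [← hθ, mul_pow])
  rwa [add_zero] at h

theorem rayIntegrable_elem_mul (hP : HasFluxGrowth t C P) (hPd : Differentiable ℂ P) (ht : 0 ≤ t)
    (hε : 0 < ε) (hX : 2 * ε * t < X) {θ : ℝ} (hθ : |Real.cos θ| = Real.sin θ) :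
    RayIntegrable (I * ε) θ fun k => elem X t k * P k := by
  obtain ⟨s₀, c, hs₀, hc, hcX⟩ := exists_regularization_margin hε hX
  refine rayIntegrable_of_decay (c := c / 4)
    (C := 2 * C * (1 + ε + 4 / c) * Real.exp ((t + s₀) * ε ^ 2)) (by positivity)
    (fun r _ => (differentiable_elem_mul hPd X t _).continuousAt) fun r hr => ?_
  simpa using hP.norm_elem_mul_le_of_boundary ht hε hc hcX (left_mem_Icc.2 hs₀.le) hθ hr.le

theorem integrableBoundaryPlus_elem_mul (hP : HasFluxGrowth t C P) (hPd : Differentiable ℂ P)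
    (ht : 0 ≤ t) (hε : 0 < ε) (hX : 2 * ε * t < X) :
    IntegrableBoundaryPlus ε fun k => elem X t k * P k :=
  ⟨hP.rayIntegrable_elem_mul hPd ht hε hX abs_cos_pi_div_four_eq_sin,
    hP.rayIntegrable_elem_mul hPd ht hε hX abs_cos_three_pi_div_four_eq_sin⟩

theorem integrable_elem_mul (hP : HasFluxGrowth t C P) (hPd : Differentiable ℂ P) (ht : 0 ≤ t)
    (hs : 0 < s) (hX : 0 ≤ X) (hε : 0 ≤ ε) :
    Integrable fun a : ℝ => elem X (t + s) (a + ε * I) * P (a + ε * I) :=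
  integrable_horizontal (fun k _ => differentiable_elem_mul hPd X (t + s) k)
    ((integrable_exp_neg_mul_sq (half_pos hs)).const_mul _)
    (fun a _ hb => hP.norm_elem_mul_le_of_strip ht hs hX a hb) (right_mem_Icc.2 hε)

theorem integral_elem_mul_eq_integral_horizontal (hP : HasFluxGrowth t C P)
    (hPd : Differentiable ℂ P) (ht : 0 ≤ t) (hs : 0 < s) (hX : 0 ≤ X) (hε : 0 ≤ ε) :
    ∫ a : ℝ, elem X (t + s) a * P a = ∫ a : ℝ, elem X (t + s) (a + ε * I) * P (a + ε * I) := by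
  have hgauss : Tendsto (fun a : ℝ => Real.exp (-(s / 2) * a ^ 2)) (cocompact ℝ) (𝓝 0) := by
    simpa using tendsto_rpow_abs_mul_exp_neg_mul_sq_cocompact (half_pos hs) 0
  rw [cocompact_eq_atBot_atTop, tendsto_sup] at hgauss
  simpa using integral_horizontal_eq hε
    (fun k _ => differentiable_elem_mul hPd X (t + s) k)
    ((integrable_exp_neg_mul_sq (half_pos hs)).const_mul _)
    (by simpa using hgauss.1.const_mul _) (by simpa using hgauss.2.const_mul _)
    fun a b hb => hP.norm_elem_mul_le_of_strip ht hs hX a hb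

theorem rayIntegral_elem_mul_eq (hP : HasFluxGrowth t C P) (hPd : Differentiable ℂ P)
    (ht : 0 ≤ t) (hε : 0 < ε) (hc : 0 < c) (hX : 2 * ε * (t + s₀) + c ≤ X) (hs : s ∈ Ioc 0 s₀)
    {a b : ℝ} (hab : a ≤ b) (hsin : ∀ θ ∈ Icc a b, 0 ≤ Real.sin θ)
    (hcos : ∀ θ ∈ Icc a b, Real.sin θ ≤ |Real.cos θ|) :
    rayIntegral (I * ε) a (fun k => elem X (t + s) k * P k) =
      rayIntegral (I * ε) b fun k => elem X (t + s) k * P k := by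
  refine rayIntegral_eq_of_decay hab (by positivity : 0 < c / 4)
    (fun θ _ r _ => differentiable_elem_mul hPd X (t + s) _) fun θ hθ r hr =>
      hP.norm_elem_mul_le_of_sector (K := c ^ 2 / (4 * s)) ht hε hc hs.1.le hs.2 hX hr.le
        (hsin θ hθ) (hcos θ hθ) ?_
  have hsquare := mul_sub_le_add_mul_sq_sub_sq (c := c) (mul_nonneg hr.le (hsin θ hθ))
    (mul_le_mul_of_nonneg_left (hcos θ hθ) hr.le) hs.1
  rwa [mul_pow r |Real.cos θ|, sq_abs, ← mul_pow] at hsquare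

theorem integral_elem_mul_eq_integralBoundaryPlus (hP : HasFluxGrowth t C P)
    (hPd : Differentiable ℂ P) (ht : 0 ≤ t) (hε : 0 < ε) (hc : 0 < c)
    (hX : 2 * ε * (t + s₀) + c ≤ X) (hs : s ∈ Ioc 0 s₀) :
    ∫ a : ℝ, elem X (t + s) a * P a =
      integralBoundaryPlus ε fun k => elem X (t + s) k * P k := by
  have hπ := Real.pi_pos
  have hs₀ : 0 < s₀ := hs.1.trans_le hs.2
  have hX₀ : 0 ≤ X := le_trans (by positivity) hX
  rw [hP.integral_elem_mul_eq_integral_horizontal hPd ht hs.1 hX₀ hε.le,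
    integral_horizontal_eq_rayIntegral_sub (f := fun k => elem X (t + s) k * P k)
      (hP.integrable_elem_mul hPd ht hs.1 hX₀ hε.le),
    integralBoundaryPlus]
  have hright := hP.rayIntegral_elem_mul_eq hPd ht hε hc hX hs (by positivity : 0 ≤ Real.pi / 4)
    (fun θ hθ => Real.sin_nonneg_of_nonneg_of_le_pi hθ.1 (by linarith [hθ.2]))
    fun θ hθ => sin_le_abs_cos_of_le hθ.1 hθ.2
  have hleft := hP.rayIntegral_elem_mul_eq hPd ht hε hc hX hs
    (by linarith : 3 * Real.pi / 4 ≤ Real.pi)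
    (fun θ hθ => Real.sin_nonneg_of_nonneg_of_le_pi (by linarith [hθ.1]) hθ.2)
    fun θ hθ => sin_le_abs_cos_of_ge hθ.1 hθ.2
  rw [hright, hleft]

theorem tendsto_rayIntegral_elem_mul (hP : HasFluxGrowth t C P) (hPd : Differentiable ℂ P)
    (ht : 0 ≤ t) (hε : 0 < ε) (hX : 2 * ε * t < X) {θ : ℝ} (hθ : |Real.cos θ| = Real.sin θ) :
    Tendsto (fun s : ℝ => rayIntegral (I * ε) θ fun k => elem X (t + s) k * P k) (𝓝[>] 0)
      (𝓝 (rayIntegral (I * ε) θ fun k => elem X t k * P k)) := by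
  obtain ⟨s₀, c, hs₀, hc, hcX⟩ := exists_regularization_margin hε hX
  refine tendsto_integral_filter_of_dominated_convergence _ (.of_forall fun s =>
      (continuousOn_rayIntegrand fun r _ =>
        (differentiable_elem_mul hPd X (t + s) _).continuousAt).aestronglyMeasurable
          measurableSet_Ioi) ?_
    ((exp_neg_integrableOn_Ioi 0 (by positivity : 0 < c / 4)).const_mul
      (2 * C * (1 + ε + 4 / c) * Real.exp ((t + s₀) * ε ^ 2))) (.of_forall fun r => ?_)
  · filter_upwards [Ioc_mem_nhdsGT hs₀] with s hs
    exact ae_restrict_of_forall_mem measurableSet_Ioi fun r hr =>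
      (norm_rayIntegrand _ _ _ r).trans_le
        (hP.norm_elem_mul_le_of_boundary ht hε hc hcX ⟨hs.1.le, hs.2⟩ hθ (le_of_lt hr))
  · have hcont : Continuous fun s : ℝ =>
        rayIntegrand (I * ε) θ (fun k => elem X (t + s) k * P k) r := by
      unfold rayIntegrand elem; fun_prop
    simpa using (hcont.tendsto 0).mono_left nhdsWithin_le_nhds

theorem tendsto_integral_elem_mul (hP : HasFluxGrowth t C P) (hPd : Differentiable ℂ P)
    (ht : 0 ≤ t) (hε : 0 < ε) (hX : 2 * ε * t < X) :
    Tendsto (fun s : ℝ => ∫ a : ℝ, elem X (t + s) a * P a) (𝓝[>] 0)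
      (𝓝 (integralBoundaryPlus ε fun k => elem X t k * P k)) := by
  obtain ⟨s₀, c, hs₀, hc, hcX⟩ := exists_regularization_margin hε hX
  refine ((hP.tendsto_rayIntegral_elem_mul hPd ht hε hX abs_cos_pi_div_four_eq_sin).sub
    (hP.tendsto_rayIntegral_elem_mul hPd ht hε hX abs_cos_three_pi_div_four_eq_sin)).congr' ?_
  filter_upwards [Ioc_mem_nhdsGT hs₀] with s hs
  exact (hP.integral_elem_mul_eq_integralBoundaryPlus hPd ht hε hc hcX hs).symm

end HasFluxGrowth

theorem integralBoundaryPlus_eq_zero_of_decay {f : ℂ → ℂ} (hε : 0 < ε) (hc : 0 < c)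
    (hf : ∀ k : ℂ, 0 < k.im → DifferentiableAt ℂ f k)
    (hb : ∀ k : ℂ, ε ≤ k.im → (k ^ 2).re ≤ 0 → ‖f k‖ ≤ C * Real.exp (-c * k.im)) :
    IntegrableBoundaryPlus ε f ∧ integralBoundaryPlus ε f = 0 := by
  have hC : 0 ≤ C := by
    have h := (norm_nonneg _).trans (hb (I * ε) (by simp) (by simp [sq_re, sq_nonneg]))
    exact nonneg_of_mul_nonneg_left h (Real.exp_pos _)
  have hdiff : ∀ θ ∈ Icc (Real.pi / 4) (3 * Real.pi / 4), ∀ r : ℝ, 0 < r →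
      DifferentiableAt ℂ f (I * ε + r * Complex.exp (I * θ)) := fun θ hθ r hr => by
    have hsin := half_le_sin_of_abs_cos_le (abs_cos_le_sin hθ.1 hθ.2)
    exact hf _ (by rw [ray_im]; positivity)
  have hdecay : ∀ θ ∈ Icc (Real.pi / 4) (3 * Real.pi / 4), ∀ r : ℝ, 0 < r →
      ‖f (I * ε + r * Complex.exp (I * θ))‖ ≤ C * Real.exp (-(c / 2) * r) := fun θ hθ r hr => by
    have hcos := abs_cos_le_sin hθ.1 hθ.2
    have hsin : r * (1 / 2) ≤ r * Real.sin θ := by gcongr; exact half_le_sin_of_abs_cos_le hcos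
    have hsq : (r * Real.cos θ) ^ 2 ≤ (r * Real.sin θ) ^ 2 := by
      rw [mul_pow, mul_pow]
      gcongr 1
      exact sq_le_sq.2 (hcos.trans (le_abs_self _))
    refine (hb _ (by rw [ray_im]; linarith) (by rw [sq_re, ray_re, ray_im]; nlinarith)).trans ?_
    refine mul_le_mul_of_nonneg_left (Real.exp_le_exp.2 ?_) hC
    rw [ray_im]
    nlinarith
  have hπ := Real.pi_pos
  have hright := left_mem_Icc.2 (by linarith : Real.pi / 4 ≤ 3 * Real.pi / 4)
  have hleft := right_mem_Icc.2 (by linarith : Real.pi / 4 ≤ 3 * Real.pi / 4)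
  exact ⟨⟨rayIntegrable_of_decay (half_pos hc) (fun r hr => (hdiff _ hright r hr).continuousAt)
      (hdecay _ hright),
    rayIntegrable_of_decay (half_pos hc) (fun r hr => (hdiff _ hleft r hr).continuousAt)
      (hdecay _ hleft)⟩,
    sub_eq_zero.2 (rayIntegral_eq_of_decay (by linarith) (half_pos hc) hdiff hdecay)⟩

end Deformation

section Determinant

theorem differentiable_h : Differentiable ℂ h := by
  unfold h; fun_prop

theorem differentiable_Δ : Differentiable ℂ Δ := by
  unfold Δ; fun_prop

theorem h_neg (k : ℂ) : h (-k) = Complex.exp (I * k) * (1 - I * k) := by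
  rw [h, neg_mul_neg, mul_neg, ← sub_eq_add_neg]

theorem Δ_eq_h_sub_h_neg (k : ℂ) : Δ k = h k - h (-k) := by
  rw [Δ, h_neg, h]

theorem Δ_neg (k : ℂ) : Δ (-k) = -Δ k := by
  rw [Δ_eq_h_sub_h_neg, Δ_eq_h_sub_h_neg, neg_neg, neg_sub]

theorem Δ_eq_mul_cos_sub_sin (k : ℂ) : Δ k = 2 * I * (k * Complex.cos k - Complex.sin k) := by
  rw [Δ, show -I * k = -k * I by ring, mul_comm I k, Complex.exp_mul_I, Complex.exp_mul_I,
    Complex.cos_neg, Complex.sin_neg]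
  ring

theorem norm_exp_I_mul (k : ℂ) : ‖Complex.exp (I * k)‖ = Real.exp (-k.im) := by
  rw [Complex.norm_exp, Complex.I_mul_re]

theorem norm_exp_neg_I_mul (k : ℂ) : ‖Complex.exp (-I * k)‖ = Real.exp k.im := by
  rw [neg_mul_comm, norm_exp_I_mul, Complex.neg_im, neg_neg]

theorem norm_one_add_I_mul_le (k : ℂ) : ‖1 + I * k‖ ≤ 1 + ‖k‖ := by
  simpa using norm_add_le (1 : ℂ) (I * k)

theorem norm_h_le (k : ℂ) : ‖h k‖ ≤ Real.exp k.im * (1 + ‖k‖) := by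
  rw [h, norm_mul, norm_exp_neg_I_mul]
  gcongr
  exact norm_one_add_I_mul_le k

theorem norm_one_sub_I_mul_le (k : ℂ) : ‖1 - I * k‖ ≤ 1 + ‖k‖ := by
  simpa [sub_eq_add_neg] using norm_one_add_I_mul_le (-k)

theorem norm_h_neg_le {k : ℂ} (hk : 0 ≤ k.im) : ‖h (-k)‖ ≤ 1 + ‖k‖ := by
  have hle := norm_h_le (-k)
  rw [norm_neg, Complex.neg_im] at hle
  exact hle.trans (mul_le_of_le_one_left (by positivity) (Real.exp_le_one_iff.2 (by linarith)))

theorem le_norm_h (k : ℂ) : Real.exp k.im * (‖k‖ - 1) ≤ ‖h k‖ := by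
  rw [h, norm_mul, norm_exp_neg_I_mul]
  gcongr
  simpa [add_comm] using norm_sub_norm_le (I * k) (-1)

/-- Comes from comparing `sin (k + k̄)` and `sin (k - k̄)` with the addition formulas. -/
theorem sin_two_mul_re_add_sinh_two_mul_im {k : ℂ} (hk : Complex.sin k = k * Complex.cos k) :
    (Real.sin (2 * k.re) : ℂ) + Real.sinh (2 * k.im) * I =
      2 * Complex.normSq (Complex.cos k) * k := by
  have hadd := Complex.sin_add k (starRingEnd ℂ k)
  have hsub := Complex.sin_sub k (starRingEnd ℂ k)
  rw [Complex.add_conj] at hadd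
  rw [Complex.sub_conj, Complex.sin_mul_I] at hsub
  rw [Complex.ofReal_sin, Complex.ofReal_sinh, hadd, hsub, Complex.cos_conj, ← Complex.mul_conj,
    hk]
  ring

theorem sin_two_mul_re_of_sin_eq {k : ℂ} (hk : Complex.sin k = k * Complex.cos k) :
    Real.sin (2 * k.re) = Complex.normSq (Complex.cos k) * (2 * k.re) := by
  have hre := congrArg Complex.re (sin_two_mul_re_add_sinh_two_mul_im hk)
  rw [← Complex.ofReal_ofNat, ← Complex.ofReal_mul, Complex.re_ofReal_mul, Complex.add_re,
    Complex.ofReal_re, Complex.re_ofReal_mul, Complex.I_re, mul_zero, add_zero] at hre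
  rw [hre]
  ring

theorem sinh_two_mul_im_of_sin_eq {k : ℂ} (hk : Complex.sin k = k * Complex.cos k) :
    Real.sinh (2 * k.im) = Complex.normSq (Complex.cos k) * (2 * k.im) := by
  have him := congrArg Complex.im (sin_two_mul_re_add_sinh_two_mul_im hk)
  rw [← Complex.ofReal_ofNat, ← Complex.ofReal_mul, Complex.im_ofReal_mul, Complex.add_im,
    Complex.ofReal_im, Complex.im_ofReal_mul, Complex.I_im, mul_one, zero_add] at him
  rw [him]
  ring

theorem sinh_lt_mul_cosh {b : ℝ} (hb : 0 < b) : Real.sinh b < b * Real.cosh b := by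
  have hmono : StrictMonoOn (fun x : ℝ => x * Real.cosh x - Real.sinh x) (Ici 0) := by
    refine strictMonoOn_of_hasDerivWithinAt_pos (f' := fun x => x * Real.sinh x) (convex_Ici 0)
      (by fun_prop) (fun x _ => ?_) fun x hx => ?_
    · have hderiv := ((hasDerivAt_id x).mul (Real.hasDerivAt_cosh x)).sub (Real.hasDerivAt_sinh x)
      exact (hderiv.congr_deriv (by simp)).hasDerivWithinAt
    · rw [interior_Ici] at hx
      exact mul_pos hx (Real.sinh_pos_iff.2 hx)
  simpa using hmono self_mem_Ici hb.le hb

theorem sinh_ne_mul_cosh {b : ℝ} (hb : b ≠ 0) : Real.sinh b ≠ b * Real.cosh b := by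
  rcases hb.lt_or_gt with hneg | hpos
  · have hlt := sinh_lt_mul_cosh (neg_pos.2 hneg)
    rw [Real.sinh_neg, Real.cosh_neg] at hlt
    exact ne_of_gt (by linarith)
  · exact (sinh_lt_mul_cosh hpos).ne

theorem im_eq_zero_of_sin_eq_mul_cos {k : ℂ} (hk : Complex.sin k = k * Complex.cos k) :
    k.im = 0 := by
  by_contra him
  have hM : 1 < Complex.normSq (Complex.cos k) := by
    have hlt := Real.self_lt_sinh_iff.2 (abs_pos.2 (mul_ne_zero two_ne_zero him))
    rw [← Real.abs_sinh, sinh_two_mul_im_of_sin_eq hk, abs_mul (Complex.normSq _),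
      abs_of_nonneg (Complex.normSq_nonneg _)] at hlt
    nlinarith [abs_nonneg (2 * k.im)]
  have hre : k.re = 0 := by
    by_contra hre
    have hlt := Real.abs_sin_lt_abs (mul_ne_zero two_ne_zero hre)
    rw [sin_two_mul_re_of_sin_eq hk, abs_mul (Complex.normSq _),
      abs_of_nonneg (Complex.normSq_nonneg _)] at hlt
    nlinarith [abs_nonneg (2 * k.re)]
  obtain ⟨b, rfl⟩ : ∃ b : ℝ, k = b * I := ⟨k.im, Complex.ext (by simp [hre]) (by simp)⟩
  rw [Complex.sin_mul_I, Complex.cos_mul_I, mul_right_comm, mul_left_inj' Complex.I_ne_zero,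
    ← Complex.ofReal_sinh, ← Complex.ofReal_cosh, ← Complex.ofReal_mul, Complex.ofReal_inj] at hk
  exact sinh_ne_mul_cosh (by simpa using him) hk

theorem Δ_ne_zero {k : ℂ} (hk : k.im ≠ 0) : Δ k ≠ 0 := by
  rw [Δ_eq_mul_cos_sub_sin]
  refine mul_ne_zero (by simp) (sub_ne_zero.2 fun hzero => hk ?_)
  exact im_eq_zero_of_sin_eq_mul_cos hzero.symm

theorem le_norm_Δ_of_lt_norm {ε : ℝ} (hε : 0 < ε) {k : ℂ} (hk : ε ≤ k.im)
    (hlarge : 5 / (1 - Real.exp (-2 * ε)) < ‖k‖) :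
    (1 - Real.exp (-2 * ε)) / 2 * ((1 + ‖k‖) * Real.exp k.im) ≤ ‖Δ k‖ := by
  set q := Real.exp (-2 * ε) with hq
  have hq₁ : q < 1 := Real.exp_lt_one_iff.2 (by linarith)
  have hq₀ : 0 < q := Real.exp_pos _
  rw [div_lt_iff₀ (sub_pos.2 hq₁)] at hlarge
  have hsmall : ‖h (-k)‖ ≤ Real.exp k.im * q * (1 + ‖k‖) := by
    refine (norm_h_le (-k)).trans ?_
    rw [norm_neg, Complex.neg_im, hq, ← Real.exp_add]
    gcongr
    linarith
  calc (1 - q) / 2 * ((1 + ‖k‖) * Real.exp k.im)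
      ≤ Real.exp k.im * (‖k‖ - 1) - Real.exp k.im * q * (1 + ‖k‖) := by
        nlinarith [mul_nonneg (Real.exp_pos k.im).le
          (by linarith : 0 ≤ (1 - q) / 2 * ‖k‖ - 1 - q - (1 - q) / 2)]
    _ ≤ ‖h k‖ - ‖h (-k)‖ := sub_le_sub (le_norm_h k) hsmall
    _ ≤ ‖Δ k‖ := by rw [Δ_eq_h_sub_h_neg]; exact norm_sub_norm_le _ _

theorem exists_le_norm_Δ {ε : ℝ} (hε : 0 < ε) :
    ∃ c > 0, ∀ k : ℂ, ε ≤ k.im → c * ((1 + ‖k‖) * Real.exp k.im) ≤ ‖Δ k‖ := by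
  have hq : 0 < (1 - Real.exp (-2 * ε)) / 2 :=
    half_pos (sub_pos.2 (Real.exp_lt_one_iff.2 (by linarith)))
  have hcompact : IsCompact
      (Metric.closedBall (0 : ℂ) (5 / (1 - Real.exp (-2 * ε))) ∩ {k | ε ≤ k.im}) :=
    (isCompact_closedBall _ _).inter_right (isClosed_le continuous_const Complex.continuous_im)
  obtain ⟨c, hc₀, hc⟩ := hcompact.exists_forall_le' (a := 0)
    (f := fun k => ‖Δ k‖ / ((1 + ‖k‖) * Real.exp k.im))
    (ContinuousOn.div differentiable_Δ.continuous.norm.continuousOn (by fun_prop)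
      fun k _ => by positivity)
    fun k hk => div_pos (norm_pos_iff.2 (Δ_ne_zero (hε.trans_le hk.2).ne')) (by positivity)
  refine ⟨min c ((1 - Real.exp (-2 * ε)) / 2), lt_min hc₀ hq, fun k hk => ?_⟩
  rcases le_or_gt ‖k‖ (5 / (1 - Real.exp (-2 * ε))) with hsmall | hlarge
  · have hk' := (le_div_iff₀ (by positivity)).1 (hc k ⟨by simpa using hsmall, hk⟩)
    exact (mul_le_mul_of_nonneg_right (min_le_left _ _) (by positivity)).trans hk'
  · exact (mul_le_mul_of_nonneg_right (min_le_right _ _) (by positivity)).trans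
      (le_norm_Δ_of_lt_norm hε hk hlarge)

end Determinant

section Transforms

variable {f : ℝ → ℝ} {T : ℝ} {k : ℂ}

theorem intervalIntegrable_ofReal {a b : ℝ} (hf : IntervalIntegrable f volume a b) :
    IntervalIntegrable (fun y => (f y : ℂ)) volume a b :=
  ⟨hf.1.ofReal, hf.2.ofReal⟩

theorem differentiable_timeTransform (hf : IntervalIntegrable f volume 0 T) :
    Differentiable ℂ fun k => timeTransform f k T := by
  intro k₀
  have hint : ∀ φ : ℝ → ℂ, Continuous φ →
      IntervalIntegrable (fun y => φ y * (f y : ℂ)) volume 0 T :=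
    fun φ hφ => (intervalIntegrable_ofReal hf).continuousOn_mul hφ.continuousOn
  have hm : ∀ k : ℂ, IntervalIntegrable (fun y : ℝ => Complex.exp (k * y) * f y) volume 0 T :=
    fun k => hint _ (by fun_prop)
  refine (intervalIntegral.hasDerivAt_integral_of_dominated_loc_of_deriv_le
    (F' := fun k y => y * Complex.exp (k * y) * f y)
    (bound := fun y => |T| * Real.exp ((‖k₀‖ + 1) * |T|) * ‖f y‖)
    (Metric.ball_mem_nhds k₀ one_pos) (.of_forall fun k => (hm k).def'.aestronglyMeasurable)
    (hm k₀) (hint _ (by fun_prop)).def'.aestronglyMeasurable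
    (.of_forall fun y hy k hk => ?_) (hf.norm.const_mul _)
    (.of_forall fun y _ k _ => ?_)).2.differentiableAt
  · have hyT : |y| ≤ |T| := by simpa using abs_sub_left_of_mem_uIcc (uIoc_subset_uIcc hy)
    have hk₀ : ‖k‖ ≤ ‖k₀‖ + 1 := by
      linarith [norm_le_norm_add_norm_sub' k k₀, mem_ball_iff_norm.1 hk]
    rw [norm_mul, norm_mul, Complex.norm_exp, Complex.norm_real, Complex.norm_real,
      Real.norm_eq_abs y]
    gcongr
    calc (k * y).re ≤ ‖k * y‖ := Complex.re_le_norm _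
      _ = ‖k‖ * |y| := by rw [norm_mul, Complex.norm_real, Real.norm_eq_abs]
      _ ≤ (‖k₀‖ + 1) * |T| := by gcongr
  · have hexp : HasDerivAt (fun k : ℂ => Complex.exp (k * y)) (Complex.exp (k * y) * (1 * y)) k :=
      ((hasDerivAt_id k).mul_const (y : ℂ)).cexp
    exact (hexp.mul_const (f y : ℂ)).congr_deriv (by ring)

theorem norm_timeTransform_le (hT : 0 ≤ T) (hf : IntervalIntegrable f volume 0 T) (k : ℂ) :
    ‖timeTransform f k T‖ ≤ (∫ τ in (0 : ℝ)..T, |f τ|) * max 1 (Real.exp (T * k.re)) := by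
  rw [timeTransform, mul_comm, ← intervalIntegral.integral_const_mul]
  refine intervalIntegral.norm_integral_le_of_norm_le hT
    (.of_forall fun τ hτ => ?_) (hf.abs.const_mul _)
  rw [norm_mul, Complex.norm_exp, Complex.norm_real, Real.norm_eq_abs, mul_comm k,
    Complex.re_ofReal_mul]
  gcongr
  rcases le_total 0 k.re with hk | hk
  · exact le_max_of_le_right (Real.exp_le_exp.2 (mul_le_mul_of_nonneg_right hτ.2 hk))
  · exact le_max_of_le_left
      (Real.exp_le_one_iff.2 (mul_nonpos_of_nonneg_of_nonpos hτ.1.le hk))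

theorem integral_abs_nonneg {a b : ℝ} (hab : a ≤ b) (f : ℝ → ℝ) : 0 ≤ ∫ y in a..b, |f y| :=
  intervalIntegral.integral_nonneg hab fun _ _ => abs_nonneg _

theorem norm_timeTransform_le_one_add_exp (hT : 0 ≤ T) (hf : IntervalIntegrable f volume 0 T)
    (k : ℂ) :
    ‖timeTransform f k T‖ ≤ (∫ τ in (0 : ℝ)..T, |f τ|) * (1 + Real.exp (T * k.re)) :=
  (norm_timeTransform_le hT hf k).trans (mul_le_mul_of_nonneg_left
    (max_le_add_of_nonneg zero_le_one (Real.exp_pos _).le) (integral_abs_nonneg hT f))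

theorem norm_spaceTransform_I_mul_le (hf : IntervalIntegrable f volume 0 1) (hk : 0 ≤ k.im) :
    ‖spaceTransform f (I * k)‖ ≤ ∫ y in (0 : ℝ)..1, |f y| := by
  have hle := norm_timeTransform_le zero_le_one hf (I * k)
  rwa [max_eq_left (Real.exp_le_one_iff.2 (by simpa using hk)), mul_one] at hle

theorem norm_spaceTransform_neg_I_mul_le (hf : IntervalIntegrable f volume 0 1) (hk : 0 ≤ k.im) :
    ‖spaceTransform f (-I * k)‖ ≤ (∫ y in (0 : ℝ)..1, |f y|) * Real.exp k.im := by
  have hre : 1 * (-I * k).re = k.im := by simp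
  have hle := norm_timeTransform_le zero_le_one hf (-I * k)
  rwa [hre, max_eq_right (Real.one_le_exp hk)] at hle

end Transforms

section FourierInversion

variable {f : ℝ → ℝ} {s x : ℝ}

theorem spaceTransform_eq_integral_indicator (f : ℝ → ℝ) (k : ℂ) :
    spaceTransform f k =
      ∫ y : ℝ, Complex.exp (k * y) * (Ioc (0 : ℝ) 1).indicator (fun y => (f y : ℂ)) y := by
  simp only [spaceTransform, intervalIntegral.integral_of_le zero_le_one,
    ← integral_indicator measurableSet_Ioc, indicator_mul_right]

theorem integral_elem_mul_exp (hs : 0 < s) (x y : ℝ) :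
    ∫ k : ℝ, elem x s k * Complex.exp (-I * k * y) =
      (Real.pi / s : ℂ) ^ (1 / 2 : ℂ) * Complex.exp (-(x - y) ^ 2 / (4 * s)) := by
  rw [← fourierIntegral_gaussian (b := s) (by simpa using hs) (x - y : ℂ)]
  refine integral_congr_ae (.of_forall fun k => ?_)
  simp only [elem, ← Complex.exp_add]
  ring_nf

theorem integrable_elem_mul_exp_mul (hs : 0 < s) (x : ℝ) {F : ℝ → ℂ} (hF : Integrable F) :
    Integrable (fun p : ℝ × ℝ => elem x s p.1 * (Complex.exp (-I * p.1 * p.2) * F p.2))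
      (volume.prod volume) := by
  have hgauss := (integrable_exp_neg_mul_sq hs).ofReal (𝕜 := ℂ).mul_prod hF
  have hphase : AEStronglyMeasurable (fun p : ℝ × ℝ => Complex.exp (I * p.1 * (x - p.2)))
      (volume.prod volume) := Continuous.aestronglyMeasurable (by fun_prop)
  refine (hgauss.bdd_mul (c := 1) hphase (.of_forall fun p => ?_)).congr (.of_forall fun p => ?_)
  · rw [Complex.norm_exp]; simp
  · simp only [elem, Complex.coe_algebraMap, Complex.ofReal_exp, ← mul_assoc, ← Complex.exp_add]
    congr 2
    push_cast
    ring

theorem integral_elem_mul_spaceTransform (hs : 0 < s) (x : ℝ)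
    (hf : IntervalIntegrable f volume 0 1) :
    ∫ k : ℝ, elem x s k * spaceTransform f (-I * k) =
      ∫ y : ℝ, (Real.pi / s : ℂ) ^ (1 / 2 : ℂ) * Complex.exp (-(x - y) ^ 2 / (4 * s)) *
        (Ioc (0 : ℝ) 1).indicator (fun y => (f y : ℂ)) y := by
  have hF := (integrable_indicator_iff measurableSet_Ioc).2 (intervalIntegrable_ofReal hf).1
  simp only [spaceTransform_eq_integral_indicator, ← integral_const_mul,
    ← integral_elem_mul_exp hs, ← integral_mul_const]
  rw [integral_integral_swap (integrable_elem_mul_exp_mul hs x hF)]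
  simp only [mul_assoc]

/-- Rescales the heat kernel to the normalisation used in
`Real.tendsto_integral_gaussian_smul'`. -/
theorem heatKernel_eq_gaussian (hs : 0 < s) (x y : ℝ) :
    (Real.pi / s : ℂ) ^ (1 / 2 : ℂ) * Complex.exp (-(x - y) ^ 2 / (4 * s)) =
      2 * Real.pi * ((Real.pi * (((4 * Real.pi ^ 2)⁻¹ * s⁻¹ : ℝ) : ℂ)) ^ (1 / 2 : ℂ) *
        Complex.exp (-(Real.pi : ℂ) ^ 2 * (((4 * Real.pi ^ 2)⁻¹ * s⁻¹ : ℝ) : ℂ) *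
          (‖x - y‖ : ℂ) ^ 2)) := by
  have hscale : (Real.pi / s : ℂ) =
      ((2 * Real.pi) ^ 2 : ℝ) * (Real.pi * ((4 * Real.pi ^ 2)⁻¹ * s⁻¹) : ℝ) := by
    rw [← Complex.ofReal_div, ← Complex.ofReal_mul]
    congr 1
    field_simp
    norm_num
  have hsqrt : (((2 * Real.pi) ^ 2 : ℝ) : ℂ) ^ (1 / 2 : ℂ) = 2 * Real.pi := by
    rw [← Complex.ofReal_one, ← Complex.ofReal_ofNat, ← Complex.ofReal_div,
      ← Complex.ofReal_cpow (by positivity), ← Real.sqrt_eq_rpow, Real.sqrt_sq (by positivity),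
      Complex.ofReal_mul]
  have hexponent : -(Real.pi : ℂ) ^ 2 * (((4 * Real.pi ^ 2)⁻¹ * s⁻¹ : ℝ) : ℂ) *
      (‖x - y‖ : ℂ) ^ 2 = -(x - y) ^ 2 / (4 * s) := by
    rw [Real.norm_eq_abs, ← Complex.ofReal_pow |x - y|, sq_abs]
    push_cast
    have hπ : (Real.pi : ℂ) ≠ 0 := Complex.ofReal_ne_zero.2 Real.pi_ne_zero
    field_simp
  rw [hexponent, hscale, Complex.mul_cpow_ofReal_nonneg (by positivity) (by positivity), hsqrt,
    Complex.ofReal_mul, mul_assoc]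

theorem tendsto_integral_elem_mul_spaceTransform (hf : IntervalIntegrable f volume 0 1)
    (hx : x ∈ Ioo (0 : ℝ) 1) (hfx : ContinuousAt f x) :
    Tendsto (fun s : ℝ => ∫ k : ℝ, elem x s k * spaceTransform f (-I * k)) (𝓝[>] 0)
      (𝓝 (2 * Real.pi * f x)) := by
  have hF := (integrable_indicator_iff measurableSet_Ioc).2 (intervalIntegrable_ofReal hf).1
  have heq : (Ioc (0 : ℝ) 1).indicator (fun y => (f y : ℂ)) =ᶠ[𝓝 x] fun y => (f y : ℂ) :=
    eventually_of_mem (Ioc_mem_nhds hx.1 hx.2) fun y hy => indicator_of_mem hy _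
  have hFx := (Complex.continuous_ofReal.continuousAt.comp hfx).congr heq.symm
  have hscale : Tendsto (fun s : ℝ => (4 * Real.pi ^ 2)⁻¹ * s⁻¹) (𝓝[>] 0) atTop :=
    tendsto_inv_nhdsGT_zero.const_mul_atTop (by positivity)
  have hlim := ((Real.tendsto_integral_gaussian_smul' hF hFx).comp hscale).const_mul
    (2 * Real.pi : ℂ)
  rw [heq.eq_of_nhds] at hlim
  refine hlim.congr' ?_
  filter_upwards [self_mem_nhdsWithin] with s hs
  simp only [Function.comp_apply, integral_elem_mul_spaceTransform hs x hf,
    heatKernel_eq_gaussian hs, Module.finrank_self, Nat.cast_one, smul_eq_mul,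
    ← integral_const_mul, mul_assoc]

end FourierInversion

section ParametricIntegrals

variable {E : Type*} [NormedAddCommGroup E] [NormedSpace ℝ E] {c d : ℝ}

theorem continuousOn_intervalIntegral_of_continuousOn {X : Type*} [TopologicalSpace X]
    [FirstCountableTopology X] {S : Set X} {F : X → ℝ → E} (hcd : c ≤ d)
    (hF : ContinuousOn (fun p : X × ℝ => F p.1 p.2) (S ×ˢ Icc c d)) :
    ContinuousOn (fun y => ∫ τ in c..d, F y τ) S := by
  have hF' : Continuous (Function.uncurry fun (y : S) τ => F y (projIcc c d hcd τ)) :=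
    hF.comp_continuous (f := fun p : S × ℝ => ((p.1 : X), (projIcc c d hcd p.2 : ℝ)))
      (by fun_prop) fun p => ⟨p.1.2, (projIcc c d hcd p.2).2⟩
  rw [continuousOn_iff_continuous_domRestrict]
  refine (intervalIntegral.continuous_parametric_intervalIntegral_of_continuous' hF' c d).congr
    fun y => intervalIntegral.integral_congr fun τ hτ => ?_
  rw [uIcc_of_le hcd] at hτ
  simp only [projIcc_of_mem hcd hτ]

theorem hasDerivAt_intervalIntegral_of_continuousOn {U : Set ℝ} {F F' : ℝ → ℝ → E} {y : ℝ}
    (hU : IsOpen U) (hcd : c ≤ d) (hF : ∀ z ∈ U, ContinuousOn (F z) (Icc c d))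
    (hF' : ContinuousOn (fun p : ℝ × ℝ => F' p.1 p.2) (U ×ˢ Icc c d))
    (hd : ∀ z ∈ U, ∀ τ ∈ Icc c d, HasDerivAt (fun z => F z τ) (F' z τ) z) (hy : y ∈ U) :
    HasDerivAt (fun y => ∫ τ in c..d, F y τ) (∫ τ in c..d, F' y τ) y := by
  obtain ⟨η, hη, hball⟩ := Metric.nhds_basis_closedBall.mem_iff.1 (hU.mem_nhds hy)
  obtain ⟨B, hB⟩ := ((isCompact_closedBall y η).prod isCompact_Icc).exists_bound_of_continuousOn
    (hF'.mono (prod_mono hball (Subset.refl (Icc c d))))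
  have hint : ∀ z ∈ U, IntervalIntegrable (F z) volume c d := fun z hz =>
    (hF z hz).intervalIntegrable_of_Icc hcd
  have hint' : IntervalIntegrable (F' y) volume c d :=
    (hF'.comp (f := fun τ => (y, τ)) (by fun_prop)
      fun τ hτ => ⟨hy, hτ⟩).intervalIntegrable_of_Icc hcd
  refine (intervalIntegral.hasDerivAt_integral_of_dominated_loc_of_deriv_le
    (bound := fun _ => B) (Metric.closedBall_mem_nhds y hη) ?_ (hint y hy)
    hint'.def'.aestronglyMeasurable (.of_forall fun τ hτ z hz => ?_)
    intervalIntegrable_const (.of_forall fun τ hτ z hz => ?_)).2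
  · filter_upwards [hU.mem_nhds hy] with z hz using (hint z hz).def'.aestronglyMeasurable
  all_goals rw [uIoc_of_le hcd] at hτ
  · exact hB (z, τ) ⟨hz, Ioc_subset_Icc_self hτ⟩
  · exact hd z (hball hz) τ (Ioc_subset_Icc_self hτ)

end ParametricIntegrals

section LagrangeIdentity

variable {a b : ℝ}

theorem exists_continuousOn_Icc_eqOn_Ioc {f f' : ℝ → ℂ} (hab : a ≤ b)
    (hf : ContinuousOn f (Ioc a b)) (hf' : ContinuousOn f' (Icc a b))
    (hd : ∀ y ∈ Ioo a b, HasDerivAt f (f' y) y) :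
    ∃ F : ℝ → ℂ, ContinuousOn F (Icc a b) ∧ EqOn F f (Ioc a b) := by
  refine ⟨fun y => f b - ∫ z in y..b, f' z, ?_, fun y hy => ?_⟩
  · rw [← uIcc_of_le hab] at hf' ⊢
    exact continuousOn_const.sub (intervalIntegral.continuousOn_primitive_interval_left
      (hf'.integrableOn_compact isCompact_uIcc))
  · have hsub : Icc y b ⊆ Ioc a b := fun z hz => ⟨hy.1.trans_le hz.1, hz.2⟩
    simp only [intervalIntegral.integral_eq_sub_of_hasDerivAt_of_le hy.2 (hf.mono hsub)
      (fun z hz => hd z ⟨hy.1.trans hz.1, hz.2⟩)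
      ((hf'.mono (hsub.trans Ioc_subset_Icc_self)).intervalIntegrable_of_Icc hy.2),
      sub_sub_cancel]

/-- By its equation, `V'` extends continuously to the left endpoint, where the boundary term then
vanishes with `φ a` and `V a`. -/
theorem wronskian_eq_integral {φ φ' V V' g : ℝ → ℂ} {κ : ℂ} (hab : a ≤ b)
    (hφ : ∀ y, HasDerivAt φ (φ' y) y) (hφ' : ∀ y, HasDerivAt φ' (κ * φ y) y) (hφa : φ a = 0)
    (hVc : ContinuousOn V (Icc a b)) (hV'c : ContinuousOn V' (Ioc a b))
    (hgc : ContinuousOn g (Icc a b)) (hV : ∀ y ∈ Ioo a b, HasDerivAt V (V' y) y)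
    (hV' : ∀ y ∈ Ioo a b, HasDerivAt V' (κ * V y + g y) y) (hVa : V a = 0) :
    φ b * V' b - φ' b * V b = ∫ y in a..b, φ y * g y := by
  rcases hab.eq_or_lt with rfl | hlt
  · simp [hφa, hVa]
  obtain ⟨W, hWc, hWV⟩ := exists_continuousOn_Icc_eqOn_Ioc hab hV'c
    ((continuousOn_const.mul hVc).add hgc) hV'
  have hW : ∀ y ∈ Ioo a b, HasDerivAt W (κ * V y + g y) y := fun y hy =>
    (hV' y hy).congr_of_eventuallyEq (eventually_of_mem (Ioc_mem_nhds hy.1 hy.2) hWV)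
  have hφc : Continuous φ := continuous_iff_continuousAt.2 fun y => (hφ y).continuousAt
  have hφ'c : Continuous φ' := continuous_iff_continuousAt.2 fun y => (hφ' y).continuousAt
  have hderiv : ∀ y ∈ Ioo a b, HasDerivAt (fun y => φ y * W y - φ' y * V y) (φ y * g y) y :=
    fun y hy => by
      refine (((hφ y).mul (hW y hy)).sub ((hφ' y).mul (hV y hy))).congr_deriv ?_
      rw [hWV (Ioo_subset_Ioc_self hy)]
      ring
  rw [intervalIntegral.integral_eq_sub_of_hasDerivAt_of_le hab
    ((hφc.continuousOn.mul hWc).sub (hφ'c.continuousOn.mul hVc)) hderiv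
    ((hφc.continuousOn.mul hgc).intervalIntegrable_of_Icc hab)]
  simp only [Pi.sub_apply, Pi.mul_apply, hφa, hVa, hWV ⟨hlt, le_rfl⟩]
  ring

end LagrangeIdentity

section TimeTransformOn

variable {f f' : ℝ → ℝ} {κ : ℂ} {δ t : ℝ}

/-- The part `∫_δ^t e^{κ τ} f(τ) dτ` of `timeTransform f κ t`. A classical solution has derivatives
only for positive times, so identities for it are first derived on `[δ, t]` with `δ > 0`. -/
noncomputable def timeTransformOn (f : ℝ → ℝ) (κ : ℂ) (δ t : ℝ) : ℂ :=
  ∫ τ in δ..t, Complex.exp (κ * τ) * (f τ : ℂ)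

theorem intervalIntegrable_exp_mul_ofReal (hf : IntervalIntegrable f volume δ t) :
    IntervalIntegrable (fun τ : ℝ => Complex.exp (κ * τ) * (f τ : ℂ)) volume δ t :=
  (intervalIntegrable_ofReal hf).continuousOn_mul (Continuous.continuousOn (by fun_prop))

theorem timeTransformOn_add {g : ℝ → ℝ} (hf : IntervalIntegrable f volume δ t)
    (hg : IntervalIntegrable g volume δ t) :
    timeTransformOn (fun τ => f τ + g τ) κ δ t =
      timeTransformOn f κ δ t + timeTransformOn g κ δ t := by
  simp only [timeTransformOn, Complex.ofReal_add, mul_add]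
  exact intervalIntegral.integral_add (intervalIntegrable_exp_mul_ofReal hf)
    (intervalIntegrable_exp_mul_ofReal hg)

theorem timeTransformOn_congr (hδt : δ ≤ t) (hff' : EqOn f f' (Icc δ t)) :
    timeTransformOn f κ δ t = timeTransformOn f' κ δ t :=
  intervalIntegral.integral_congr fun τ hτ => by
    simp only [hff' (uIcc_of_le hδt ▸ hτ)]

theorem tendsto_timeTransformOn (ht : 0 < t) (hf : IntervalIntegrable f volume 0 t) (κ : ℂ) :
    Tendsto (fun δ => timeTransformOn f κ δ t) (𝓝[>] 0) (𝓝 (timeTransform f κ t)) := by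
  have hcont := intervalIntegral.continuousOn_primitive_interval_left
    ((intervalIntegrable_iff' (by finiteness)).1 (intervalIntegrable_exp_mul_ofReal (κ := κ) hf))
  rw [uIcc_of_le ht.le] at hcont
  exact (hcont 0 (left_mem_Icc.2 ht.le)).tendsto.mono_left
    (nhdsWithin_le_of_mem (Icc_mem_nhdsGT ht))

theorem timeTransformOn_deriv (hδt : δ ≤ t) (hf' : ContinuousOn f' (Icc δ t))
    (hd : ∀ τ ∈ Icc δ t, HasDerivAt f (f' τ) τ) :
    timeTransformOn f' κ δ t = Complex.exp (κ * t) * f t - Complex.exp (κ * δ) * f δ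
      - κ * timeTransformOn f κ δ t := by
  have hexp : ∀ τ : ℝ, HasDerivAt (fun τ : ℝ => Complex.exp (κ * τ))
      (Complex.exp (κ * τ) * (κ * 1)) τ := fun τ =>
    (Complex.ofRealCLM.hasDerivAt.const_mul κ).cexp
  rw [timeTransformOn, intervalIntegral.integral_mul_deriv_eq_deriv_mul (fun τ _ => hexp τ)
    (fun τ hτ => (hd τ (uIcc_of_le hδt ▸ hτ)).ofReal_comp)
    (Continuous.intervalIntegrable (by fun_prop) _ _)
    (intervalIntegrable_ofReal (hf'.intervalIntegrable_of_Icc hδt)), timeTransformOn,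
    ← intervalIntegral.integral_const_mul]
  congr 2 with τ
  ring

theorem continuousOn_exp_mul_ofReal {X : Type*} [TopologicalSpace X] {S : Set X} {J : Set ℝ}
    {F : X → ℝ → ℝ} (hF : ContinuousOn (fun p : X × ℝ => F p.1 p.2) (S ×ˢ J)) :
    ContinuousOn (fun p : X × ℝ => Complex.exp (κ * p.2) * (F p.1 p.2 : ℂ)) (S ×ˢ J) :=
  (Continuous.continuousOn (by fun_prop)).mul (Complex.continuous_ofReal.comp_continuousOn hF)

theorem continuousOn_timeTransformOn {S : Set ℝ} {F : ℝ → ℝ → ℝ} (hδt : δ ≤ t)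
    (hF : ContinuousOn (fun p : ℝ × ℝ => F p.1 p.2) (S ×ˢ Icc δ t)) :
    ContinuousOn (fun y => timeTransformOn (F y) κ δ t) S :=
  continuousOn_intervalIntegral_of_continuousOn hδt (continuousOn_exp_mul_ofReal hF)

theorem hasDerivAt_timeTransformOn {U : Set ℝ} {F F' : ℝ → ℝ → ℝ} {y : ℝ} (hU : IsOpen U)
    (hδt : δ ≤ t) (hF : ContinuousOn (fun p : ℝ × ℝ => F p.1 p.2) (U ×ˢ Icc δ t))
    (hF' : ContinuousOn (fun p : ℝ × ℝ => F' p.1 p.2) (U ×ˢ Icc δ t))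
    (hd : ∀ z ∈ U, ∀ τ ∈ Icc δ t, HasDerivAt (fun z => F z τ) (F' z τ) z) (hy : y ∈ U) :
    HasDerivAt (fun y => timeTransformOn (F y) κ δ t) (timeTransformOn (F' y) κ δ t) y :=
  hasDerivAt_intervalIntegral_of_continuousOn
    (F := fun y τ => Complex.exp (κ * τ) * (F y τ : ℂ)) hU hδt
    (fun z hz => (continuousOn_exp_mul_ofReal hF).comp (f := fun τ => (z, τ)) (by fun_prop)
      fun _ hτ => ⟨hz, hτ⟩)
    (continuousOn_exp_mul_ofReal hF')
    (fun z hz τ hτ => (hd z hz τ hτ).ofReal_comp.const_mul _) hy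

end TimeTransformOn

section SineTransform

variable {f : ℝ → ℝ}

/-- The sine transform `∫₀¹ sin(k y) f(y) dy`, which up to the factor `-i` is the odd part
in `k` of `spaceTransform f (-ik)`. -/
noncomputable def sineTransform (f : ℝ → ℝ) (k : ℂ) : ℂ :=
  ∫ y in (0 : ℝ)..1, Complex.sin (k * y) * (f y : ℂ)

theorem spaceTransform_neg_sub (hf : IntervalIntegrable f volume 0 1) (k : ℂ) :
    spaceTransform f (-I * k) - spaceTransform f (I * k) = -2 * I * sineTransform f k := by
  rw [spaceTransform, spaceTransform, sineTransform,
    ← intervalIntegral.integral_sub (intervalIntegrable_exp_mul_ofReal hf)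
      (intervalIntegrable_exp_mul_ofReal hf), ← intervalIntegral.integral_const_mul]
  congr 1 with y
  rw [show -I * k * y = -(k * y) * I by ring, show I * k * y = (k * y) * I by ring,
    Complex.exp_mul_I, Complex.exp_mul_I, Complex.cos_neg, Complex.sin_neg]
  ring

theorem intervalIntegrable_sin_mul_ofReal (hf : IntervalIntegrable f volume 0 1) (k : ℂ) :
    IntervalIntegrable (fun y : ℝ => Complex.sin (k * y) * (f y : ℂ)) volume 0 1 :=
  (intervalIntegrable_ofReal hf).continuousOn_mul (Continuous.continuousOn (by fun_prop))

theorem hasDerivAt_sin_mul (k : ℂ) (y : ℝ) :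
    HasDerivAt (fun y : ℝ => Complex.sin (k * y)) (k * Complex.cos (k * y)) y := by
  refine (((hasDerivAt_id (y : ℂ)).const_mul k).csin.comp_ofReal).congr_deriv ?_
  simp only [id_eq]
  ring

theorem hasDerivAt_mul_cos_mul (k : ℂ) (y : ℝ) :
    HasDerivAt (fun y : ℝ => k * Complex.cos (k * y)) (-k ^ 2 * Complex.sin (k * y)) y := by
  refine ((((hasDerivAt_id (y : ℂ)).const_mul k).ccos.const_mul k).comp_ofReal).congr_deriv ?_
  simp only [id_eq]
  ring

end SineTransform

/-- The derivative `u_x(x, t)`, one-sided at `x = 1`. -/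
noncomputable def spaceDeriv (u : ℝ → ℝ → ℝ) (x t : ℝ) : ℝ :=
  derivWithin (fun y => u y t) (Icc 0 1) x

namespace IsClassicalSolution

variable {u₀ j : ℝ → ℝ} {u : ℝ → ℝ → ℝ} {x y δ t : ℝ}

theorem continuousOn_slice (hu : IsClassicalSolution u₀ j u) (ht : 0 ≤ t) :
    ContinuousOn (fun x => u x t) (Icc 0 1) :=
  hu.continuousOn.comp (f := fun x => (x, t)) (by fun_prop) fun _ hx => ⟨hx, ht⟩

theorem continuousOn_time (hu : IsClassicalSolution u₀ j u) (hx : x ∈ Icc (0 : ℝ) 1) :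
    ContinuousOn (u x) (Ici 0) :=
  hu.continuousOn.comp (f := fun τ => (x, τ)) (by fun_prop) fun _ hτ => ⟨hx, hτ⟩

theorem continuousOn_initial (hu : IsClassicalSolution u₀ j u) : ContinuousOn u₀ (Icc 0 1) :=
  (hu.continuousOn_slice le_rfl).congr fun x hx => (hu.initial x hx).symm

theorem intervalIntegrable_slice (hu : IsClassicalSolution u₀ j u) (ht : 0 ≤ t) :
    IntervalIntegrable (fun x => u x t) volume 0 1 :=
  (hu.continuousOn_slice ht).intervalIntegrable_of_Icc zero_le_one

theorem intervalIntegrable_initial (hu : IsClassicalSolution u₀ j u) :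
    IntervalIntegrable u₀ volume 0 1 :=
  hu.continuousOn_initial.intervalIntegrable_of_Icc zero_le_one

theorem intervalIntegrable_boundary (hu : IsClassicalSolution u₀ j u) (hδ : 0 ≤ δ) (hδt : δ ≤ t) :
    IntervalIntegrable (u 1) volume δ t :=
  ((hu.continuousOn_time (right_mem_Icc.2 zero_le_one)).mono
    fun _ hτ => hδ.trans hτ.1).intervalIntegrable_of_Icc hδt

theorem hasDerivAt_x (hu : IsClassicalSolution u₀ j u) (hx : x ∈ Ioo (0 : ℝ) 1) (ht : 0 < t) :
    HasDerivAt (fun y => u y t) (spaceDeriv u x t) x :=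
  (hu.differentiable_x x (Ioo_subset_Ioc_self hx) t ht).hasDerivWithinAt.hasDerivAt
    (Icc_mem_nhds hx.1 hx.2)

theorem hasDerivAt_spaceDeriv (hu : IsClassicalSolution u₀ j u) (hx : x ∈ Ioo (0 : ℝ) 1)
    (ht : 0 < t) : HasDerivAt (fun y => spaceDeriv u y t) (deriv (u x) t) x := by
  refine (hu.heat x hx t ht).congr_of_eventuallyEq ?_
  filter_upwards [Ioo_mem_nhds hx.1 hx.2] with y hy
  exact (hu.hasDerivAt_x hy ht).deriv.symm

theorem spaceDeriv_one (hu : IsClassicalSolution u₀ j u) (ht : 0 < t) :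
    spaceDeriv u 1 t = j t + u 1 t := by
  rw [← hu.robin t ht, spaceDeriv, sub_add_cancel]

theorem continuousOn_timeTransformOn (hu : IsClassicalSolution u₀ j u) (κ : ℂ) (hδ : 0 < δ)
    (hδt : δ ≤ t) : ContinuousOn (fun y => timeTransformOn (u y) κ δ t) (Icc 0 1) :=
  RobinHeat.continuousOn_timeTransformOn hδt
    (hu.continuousOn.mono (prod_mono_right fun _ hτ => hδ.le.trans hτ.1))

theorem continuousOn_timeTransformOn_spaceDeriv (hu : IsClassicalSolution u₀ j u) (κ : ℂ)
    (hδ : 0 < δ) (hδt : δ ≤ t) :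
    ContinuousOn (fun y => timeTransformOn (spaceDeriv u y) κ δ t) (Ioc 0 1) :=
  RobinHeat.continuousOn_timeTransformOn hδt
    (hu.continuousOn_x.mono (prod_mono_right fun _ hτ => hδ.trans_le hτ.1))

theorem hasDerivAt_timeTransformOn (hu : IsClassicalSolution u₀ j u) (κ : ℂ) (hδ : 0 < δ)
    (hδt : δ ≤ t) (hy : y ∈ Ioo (0 : ℝ) 1) :
    HasDerivAt (fun y => timeTransformOn (u y) κ δ t) (timeTransformOn (spaceDeriv u y) κ δ t) y :=
  RobinHeat.hasDerivAt_timeTransformOn isOpen_Ioo hδt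
    (hu.continuousOn.mono (prod_mono Ioo_subset_Icc_self fun _ hτ => hδ.le.trans hτ.1))
    (hu.continuousOn_x.mono (prod_mono Ioo_subset_Ioc_self fun _ hτ => hδ.trans_le hτ.1))
    (fun _ hz _ hτ => hu.hasDerivAt_x hz (hδ.trans_le hτ.1)) hy

theorem hasDerivAt_timeTransformOn_spaceDeriv (hu : IsClassicalSolution u₀ j u) (κ : ℂ)
    (hδ : 0 < δ) (hδt : δ ≤ t) (hy : y ∈ Ioo (0 : ℝ) 1) :
    HasDerivAt (fun y => timeTransformOn (spaceDeriv u y) κ δ t)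
      (-κ * timeTransformOn (u y) κ δ t +
        (Complex.exp (κ * t) * u y t - Complex.exp (κ * δ) * u y δ)) y := by
  have hpos : ∀ τ ∈ Icc δ t, 0 < τ := fun τ hτ => hδ.trans_le hτ.1
  have hut := hu.continuousOn_t.mono (prod_mono_right (s := Ioo (0 : ℝ) 1) hpos)
  have hparts : timeTransformOn (deriv (u y)) κ δ t = _ :=
    timeTransformOn_deriv (κ := κ) hδt
      (hut.comp (f := fun τ => (y, τ)) (by fun_prop) fun τ hτ => ⟨hy, hτ⟩)
      fun τ hτ => (hu.differentiable_t y hy τ (hpos τ hτ)).hasDerivAt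
  refine (RobinHeat.hasDerivAt_timeTransformOn isOpen_Ioo hδt
    (hu.continuousOn_x.mono (prod_mono Ioo_subset_Ioc_self hpos)) hut
    (fun z hz τ hτ => hu.hasDerivAt_spaceDeriv hz (hpos τ hτ)) hy).congr_deriv ?_
  rw [hparts]
  ring

theorem timeTransformOn_zero (hu : IsClassicalSolution u₀ j u) (κ : ℂ) (hδ : 0 < δ)
    (hδt : δ ≤ t) : timeTransformOn (u 0) κ δ t = 0 := by
  rw [timeTransformOn_congr (f' := 0) hδt fun τ hτ => hu.dirichlet τ (hδ.trans_le hτ.1)]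
  simp [timeTransformOn]

theorem continuousOn_sineTransform (hu : IsClassicalSolution u₀ j u) (k : ℂ) :
    ContinuousOn (fun τ => sineTransform (fun y => u y τ) k) (Ici 0) := by
  refine continuousOn_intervalIntegral_of_continuousOn zero_le_one ?_
  exact (Continuous.continuousOn (by fun_prop)).mul (Complex.continuous_ofReal.comp_continuousOn
    (hu.continuousOn.comp (f := fun p : ℝ × ℝ => (p.2, p.1)) (by fun_prop)
      fun p hp => ⟨hp.2, hp.1⟩))

theorem sine_relation_timeTransformOn_spaceDeriv (hu : IsClassicalSolution u₀ j u) (k : ℂ)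
    (hδ : 0 < δ) (hδt : δ ≤ t) :
    Complex.sin k * timeTransformOn (spaceDeriv u 1) (k ^ 2) δ t
        - k * Complex.cos k * timeTransformOn (u 1) (k ^ 2) δ t
      = Complex.exp (k ^ 2 * t) * sineTransform (fun y => u y t) k
        - Complex.exp (k ^ 2 * δ) * sineTransform (fun y => u y δ) k := by
  have hslice : ∀ τ : ℝ, 0 < τ →
      ContinuousOn (fun y => Complex.exp (k ^ 2 * τ) * (u y τ : ℂ)) (Icc 0 1) := fun τ hτ =>
    continuousOn_const.mul
      (Complex.continuous_ofReal.comp_continuousOn (hu.continuousOn_slice hτ.le))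
  have hwronskian := wronskian_eq_integral zero_le_one (hasDerivAt_sin_mul k)
    (hasDerivAt_mul_cos_mul k) (by simp) (hu.continuousOn_timeTransformOn (k ^ 2) hδ hδt)
    (hu.continuousOn_timeTransformOn_spaceDeriv (k ^ 2) hδ hδt)
    ((hslice t (hδ.trans_le hδt)).sub (hslice δ hδ))
    (fun y hy => hu.hasDerivAt_timeTransformOn _ hδ hδt hy)
    (fun y hy => hu.hasDerivAt_timeTransformOn_spaceDeriv _ hδ hδt hy)
    (hu.timeTransformOn_zero _ hδ hδt)
  simp only [Complex.ofReal_one, mul_one, Pi.sub_apply, mul_sub] at hwronskian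
  simp only [hwronskian, sineTransform, ← intervalIntegral.integral_const_mul]
  have hsine : ∀ τ : ℝ, 0 < τ → IntervalIntegrable (fun y : ℝ => Complex.exp (k ^ 2 * τ) *
      (Complex.sin (k * y) * (u y τ : ℂ))) volume 0 1 := fun τ hτ =>
    (intervalIntegrable_sin_mul_ofReal (hu.intervalIntegrable_slice hτ.le) k).const_mul _
  rw [← intervalIntegral.integral_sub (hsine t (hδ.trans_le hδt)) (hsine δ hδ)]
  congr 1 with y
  ring

theorem sine_relation_timeTransformOn (hu : IsClassicalSolution u₀ j u) (k : ℂ) (hδ : 0 < δ)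
    (hδt : δ ≤ t) (hj : IntervalIntegrable j volume δ t) :
    Complex.sin k * timeTransformOn j (k ^ 2) δ t
        + (Complex.sin k - k * Complex.cos k) * timeTransformOn (u 1) (k ^ 2) δ t
      = Complex.exp (k ^ 2 * t) * sineTransform (fun y => u y t) k
        - Complex.exp (k ^ 2 * δ) * sineTransform (fun y => u y δ) k := by
  have hrobin : timeTransformOn (spaceDeriv u 1) (k ^ 2) δ t =
      timeTransformOn j (k ^ 2) δ t + timeTransformOn (u 1) (k ^ 2) δ t := by
    rw [← timeTransformOn_add hj (hu.intervalIntegrable_boundary hδ.le hδt)]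
    exact timeTransformOn_congr hδt fun τ hτ => hu.spaceDeriv_one (hδ.trans_le hτ.1)
  rw [← hu.sine_relation_timeTransformOn_spaceDeriv k hδ hδt, hrobin]
  ring

theorem sine_relation (hu : IsClassicalSolution u₀ j u) (k : ℂ) (ht : 0 < t)
    (hj : IntervalIntegrable j volume 0 t) :
    Complex.sin k * timeTransform j (k ^ 2) t
        + (Complex.sin k - k * Complex.cos k) * timeTransform (u 1) (k ^ 2) t
      = Complex.exp (k ^ 2 * t) * sineTransform (fun y => u y t) k - sineTransform u₀ k := by
  have hinitial : sineTransform (fun y => u y 0) k = sineTransform u₀ k :=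
    intervalIntegral.integral_congr fun y hy => by
      simp only [hu.initial y (uIcc_of_le (zero_le_one (α := ℝ)) ▸ hy)]
  have hleft := ((tendsto_timeTransformOn ht hj (k ^ 2)).const_mul (Complex.sin k)).add
    ((tendsto_timeTransformOn ht (hu.intervalIntegrable_boundary le_rfl ht.le)
      (k ^ 2)).const_mul (Complex.sin k - k * Complex.cos k))
  have hexp : Tendsto (fun δ : ℝ => Complex.exp (k ^ 2 * δ)) (𝓝[>] 0) (𝓝 1) :=
    tendsto_nhdsWithin_of_tendsto_nhds (Continuous.tendsto' (by fun_prop) _ _ (by simp))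
  have hsine : Tendsto (fun δ => sineTransform (fun y => u y δ) k) (𝓝[>] 0)
      (𝓝 (sineTransform u₀ k)) := by
    rw [← hinitial]
    exact ((hu.continuousOn_sineTransform k) 0 self_mem_Ici).mono Ioi_subset_Ici_self
  have hright := (hexp.mul hsine).const_sub
    (Complex.exp (k ^ 2 * t) * sineTransform (fun y => u y t) k)
  rw [one_mul] at hright
  refine tendsto_nhds_unique hleft (hright.congr' ?_)
  filter_upwards [Ioc_mem_nhdsGT ht] with δ hδ
  refine (hu.sine_relation_timeTransformOn k hδ.1 hδ.2 (hj.mono_set ?_)).symm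
  rw [uIcc_of_le hδ.2, uIcc_of_le ht.le]
  exact Icc_subset_Icc_left hδ.1.le

/-- The odd part in `k` of the integral identity over `[0, 1] × [0, t]`: the unknown transform of
`u_x(0, ·)` depends on `k ^ 2` only and drops out. -/
theorem global_relation (hu : IsClassicalSolution u₀ j u) (k : ℂ) (ht : 0 < t)
    (hj : IntervalIntegrable j volume 0 t) :
    Complex.exp (k ^ 2 * t) * (spaceTransform (fun x => u x t) (-I * k)
        - spaceTransform (fun x => u x t) (I * k))
      = spaceTransform u₀ (-I * k) - spaceTransform u₀ (I * k)
        + (Complex.exp (-I * k) - Complex.exp (I * k)) * timeTransform j (k ^ 2) t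
        + Δ k * timeTransform (u 1) (k ^ 2) t := by
  rw [spaceTransform_neg_sub (hu.intervalIntegrable_slice ht.le),
    spaceTransform_neg_sub hu.intervalIntegrable_initial, Δ_eq_mul_cos_sub_sin,
    show -I * k = -k * I by ring, mul_comm I k, Complex.exp_mul_I, Complex.exp_mul_I,
    Complex.cos_neg, Complex.sin_neg]
  linear_combination (2 * I) * hu.sine_relation k ht hj

end IsClassicalSolution

section ContourAlgebra

variable {p : ℂ} {θ ε : ℝ} {f g : ℂ → ℂ}

theorem rayIntegrand_sub (p : ℂ) (θ : ℝ) (f g : ℂ → ℂ) :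
    rayIntegrand p θ (fun k => f k - g k) = rayIntegrand p θ f - rayIntegrand p θ g :=
  funext fun _ => sub_mul _ _ _

theorem rayIntegrand_eqOn (hε : 0 < ε) (hθ : 0 ≤ Real.sin θ) (hfg : EqOn f g {k | 0 < k.im}) :
    EqOn (rayIntegrand (I * ε) θ f) (rayIntegrand (I * ε) θ g) (Ioi 0) := fun r hr => by
  have him : 0 < (I * ε + r * Complex.exp (I * θ)).im := by
    rw [ray_im]
    exact add_pos_of_pos_of_nonneg hε (mul_nonneg (le_of_lt hr) hθ)
  simp only [rayIntegrand, hfg him]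

theorem rayIntegrable_sub (hf : RayIntegrable p θ f) (hg : RayIntegrable p θ g) :
    RayIntegrable p θ fun k => f k - g k := by
  rw [RayIntegrable, rayIntegrand_sub]
  exact Integrable.sub hf hg

theorem rayIntegral_sub (hf : RayIntegrable p θ f) (hg : RayIntegrable p θ g) :
    rayIntegral p θ (fun k => f k - g k) = rayIntegral p θ f - rayIntegral p θ g := by
  rw [rayIntegral, rayIntegrand_sub]
  exact integral_sub hf hg

theorem sin_pi_div_four_nonneg : 0 ≤ Real.sin (Real.pi / 4) :=
  abs_cos_pi_div_four_eq_sin ▸ abs_nonneg _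

theorem sin_three_pi_div_four_nonneg : 0 ≤ Real.sin (3 * Real.pi / 4) :=
  abs_cos_three_pi_div_four_eq_sin ▸ abs_nonneg _

theorem integrableBoundaryPlus_congr (hε : 0 < ε) (hfg : EqOn f g {k | 0 < k.im}) :
    IntegrableBoundaryPlus ε f ↔ IntegrableBoundaryPlus ε g :=
  and_congr
    (integrableOn_congr_fun (rayIntegrand_eqOn hε sin_pi_div_four_nonneg hfg) measurableSet_Ioi)
    (integrableOn_congr_fun (rayIntegrand_eqOn hε sin_three_pi_div_four_nonneg hfg)
      measurableSet_Ioi)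

theorem integralBoundaryPlus_congr (hε : 0 < ε) (hfg : EqOn f g {k | 0 < k.im}) :
    integralBoundaryPlus ε f = integralBoundaryPlus ε g :=
  congrArg₂ (· - ·)
    (setIntegral_congr_fun measurableSet_Ioi (rayIntegrand_eqOn hε sin_pi_div_four_nonneg hfg))
    (setIntegral_congr_fun measurableSet_Ioi
      (rayIntegrand_eqOn hε sin_three_pi_div_four_nonneg hfg))

theorem integrableBoundaryPlus_sub (hf : IntegrableBoundaryPlus ε f)
    (hg : IntegrableBoundaryPlus ε g) : IntegrableBoundaryPlus ε fun k => f k - g k :=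
  ⟨rayIntegrable_sub hf.1 hg.1, rayIntegrable_sub hf.2 hg.2⟩

theorem integralBoundaryPlus_sub (hf : IntegrableBoundaryPlus ε f)
    (hg : IntegrableBoundaryPlus ε g) :
    integralBoundaryPlus ε (fun k => f k - g k) =
      integralBoundaryPlus ε f - integralBoundaryPlus ε g := by
  rw [integralBoundaryPlus, rayIntegral_sub hf.1 hg.1, rayIntegral_sub hf.2 hg.2,
    sub_sub_sub_comm, integralBoundaryPlus, integralBoundaryPlus]

end ContourAlgebra

section TransformAlgebra

theorem exp_neg_I_mul_mul_exp_I_mul (k : ℂ) : Complex.exp (-I * k) * Complex.exp (I * k) = 1 := by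
  rw [← Complex.exp_add, neg_mul, neg_add_cancel, Complex.exp_zero]

theorem norm_exp_sq_mul (k : ℂ) (t : ℝ) :
    ‖Complex.exp (k ^ 2 * t)‖ = Real.exp (t * (k ^ 2).re) := by
  rw [Complex.norm_exp, Complex.re_mul_ofReal, mul_comm]

theorem elem_neg_eq (x t : ℝ) (k : ℂ) :
    elem x t (-k) = elem (1 - x) t k * Complex.exp (-I * k) := by
  rw [elem, elem, ← Complex.exp_add]
  congr 1
  push_cast
  ring

theorem elem_eq_elem_add_mul (x t s : ℝ) (k : ℂ) :
    elem x s k = elem x (t + s) k * Complex.exp (k ^ 2 * t) := by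
  rw [elem, elem, ← Complex.exp_add]
  congr 1
  push_cast
  ring

theorem μ₀_neg (u₀ j : ℝ → ℝ) (t : ℝ) (k : ℂ) : μ₀ u₀ j t (-k) = -μ₀ u₀ j t k := by
  simp only [μ₀, mul_neg, neg_mul, neg_neg, neg_sq]
  ring

theorem ν₁Future_neg (u : ℝ → ℝ → ℝ) (T : ℝ) (k : ℂ) : ν₁Future u T (-k) = -ν₁Future u T k := by
  simp only [ν₁Future, mul_neg, neg_mul, neg_neg, neg_sq]
  ring

end TransformAlgebra

/-- The transform `∫₀ᵗ e^{k² s} u_x(0, s) ds` of the flux at `x = 0`. A classical solution need not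
have a derivative at `x = 0`, so the flux is expressed through the other terms of its integral
identity, in the form whose exponentials are bounded for `Im k ≥ 0`. -/
noncomputable def leftFlux (u₀ j : ℝ → ℝ) (u : ℝ → ℝ → ℝ) (t : ℝ) (k : ℂ) : ℂ :=
  spaceTransform u₀ (I * k) + Complex.exp (I * k) * timeTransform j (k ^ 2) t
    + h (-k) * timeTransform (u 1) (k ^ 2) t
    - Complex.exp (k ^ 2 * t) * spaceTransform (fun x => u x t) (I * k)

/-- The transform `∫₀ᵗ e^{k² s} (u_x(1, s) - i k u(1, s)) ds` of the flux at `x = 1`, in which `u_x`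
is eliminated by the Robin condition. -/
noncomputable def rightFlux (j : ℝ → ℝ) (u : ℝ → ℝ → ℝ) (t : ℝ) (k : ℂ) : ℂ :=
  timeTransform j (k ^ 2) t + (1 - I * k) * timeTransform (u 1) (k ^ 2) t

theorem exp_mul_rightFlux (u₀ j : ℝ → ℝ) (u : ℝ → ℝ → ℝ) (t : ℝ) (k : ℂ) :
    Complex.exp (I * k) * rightFlux j u t k =
      leftFlux u₀ j u t k - spaceTransform u₀ (I * k)
        + Complex.exp (k ^ 2 * t) * spaceTransform (fun x => u x t) (I * k) := by
  rw [rightFlux, leftFlux, h_neg]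
  ring

namespace IsClassicalSolution

variable {u₀ j : ℝ → ℝ} {u : ℝ → ℝ → ℝ} {t : ℝ}

theorem leftFlux_neg (hu : IsClassicalSolution u₀ j u) (ht : 0 < t)
    (hj : IntervalIntegrable j volume 0 t) (k : ℂ) :
    leftFlux u₀ j u t (-k) = leftFlux u₀ j u t k := by
  have hglobal := hu.global_relation k ht hj
  rw [Δ_eq_h_sub_h_neg] at hglobal
  simp only [leftFlux, neg_neg, neg_sq, ← neg_mul_comm]
  linear_combination -hglobal

/-- The antisymmetric combination `h(k) L(k) - h(-k) L(-k)` cancels the unknown transform of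
`u(1, ·)` in the flux `L`. -/
theorem Δ_mul_leftFlux (hu : IsClassicalSolution u₀ j u) (ht : 0 < t)
    (hj : IntervalIntegrable j volume 0 t) (k : ℂ) :
    Δ k * leftFlux u₀ j u t k = μ₀ u₀ j t k + ν₀Future u t k := by
  have hexp := exp_neg_I_mul_mul_exp_I_mul k
  calc Δ k * leftFlux u₀ j u t k
      = h k * leftFlux u₀ j u t k - h (-k) * leftFlux u₀ j u t (-k) := by
        rw [Δ_eq_h_sub_h_neg, hu.leftFlux_neg ht hj, sub_mul]
    _ = μ₀ u₀ j t k + ν₀Future u t k := by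
        simp only [leftFlux, μ₀, ν₀Future, neg_neg, neg_sq, ← neg_mul_comm, h_neg]
        rw [h]
        linear_combination (2 * I * k * timeTransform j (k ^ 2) t) * hexp

theorem Δ_mul_rightFlux (hu : IsClassicalSolution u₀ j u) (ht : 0 < t)
    (hj : IntervalIntegrable j volume 0 t) (k : ℂ) :
    Δ k * (Complex.exp (I * k) * rightFlux j u t k) =
      -(μ₁ u₀ j t (-k) + h (-k) * ν₁Future u t (-k)) := by
  have hleft := hu.Δ_mul_leftFlux ht hj k
  rw [exp_mul_rightFlux u₀, ν₁Future_neg, μ₁, μ₀_neg, Δ_neg, neg_mul_neg]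
  rw [ν₀Future] at hleft
  rw [ν₁Future]
  linear_combination hleft
    + Complex.exp (k ^ 2 * t) * spaceTransform (fun x => u x t) (I * k) * Δ_eq_h_sub_h_neg k

theorem elem_div_Δ_mul_μ₀ (hu : IsClassicalSolution u₀ j u) (ht : 0 < t)
    (hj : IntervalIntegrable j volume 0 t) (x : ℝ) {k : ℂ} (hk : k.im ≠ 0) :
    elem x t k / Δ k * μ₀ u₀ j t k =
      elem x t k * leftFlux u₀ j u t k - elem x t k / Δ k * ν₀Future u t k := by
  have hΔ := Δ_ne_zero hk
  rw [← mul_div_cancel_left₀ (leftFlux u₀ j u t k) hΔ, hu.Δ_mul_leftFlux ht hj]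
  ring

theorem elem_div_Δ_mul_μ₁_neg (hu : IsClassicalSolution u₀ j u) (ht : 0 < t)
    (hj : IntervalIntegrable j volume 0 t) (x : ℝ) {k : ℂ} (hk : k.im ≠ 0) :
    elem x t (-k) / Δ (-k) * μ₁ u₀ j t (-k) =
      elem (1 - x) t k * rightFlux j u t k
        - elem x t (-k) / Δ (-k) * (h (-k) * ν₁Future u t (-k)) := by
  have hΔ := Δ_ne_zero hk
  have hreflect : elem (1 - x) t k = elem x t (-k) * Complex.exp (I * k) := by
    rw [elem_neg_eq, mul_assoc, exp_neg_I_mul_mul_exp_I_mul, mul_one]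
  rw [hreflect, Δ_neg, mul_assoc, ← mul_div_cancel_left₀ (Complex.exp (I * k) * _) hΔ,
    hu.Δ_mul_rightFlux ht hj]
  ring

theorem elem_mul_spaceTransform_eq (hu : IsClassicalSolution u₀ j u) (ht : 0 < t)
    (hj : IntervalIntegrable j volume 0 t) (x s : ℝ) (k : ℂ) :
    elem x s k * spaceTransform (fun y => u y t) (-I * k) =
      elem x (t + s) k * spaceTransform u₀ (-I * k) - elem x (t + s) k * leftFlux u₀ j u t k
        + elem (1 - x) (t + s) (-k) * rightFlux j u t (-k) := by
  have hright := exp_mul_rightFlux u₀ j u t (-k)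
  rw [hu.leftFlux_neg ht hj, neg_sq, ← neg_mul_comm] at hright
  rw [elem_eq_elem_add_mul x t s, elem_neg_eq, sub_sub_cancel]
  linear_combination -elem x (t + s) k * hright

end IsClassicalSolution

section RealLine

variable {f : ℝ → ℝ} {σ s : ℝ}

theorem differentiable_spaceTransform (hf : IntervalIntegrable f volume 0 1) :
    Differentiable ℂ (spaceTransform f) :=
  differentiable_timeTransform hf

theorem norm_elem_mul_spaceTransform_le (hf : IntervalIntegrable f volume 0 1) (hσ : s ≤ σ)
    (x k : ℝ) :
    ‖elem x σ k * spaceTransform f (-I * k)‖ ≤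
      (∫ y in (0 : ℝ)..1, |f y|) * Real.exp (-s * k ^ 2) := by
  have htransform := norm_spaceTransform_neg_I_mul_le hf (k := k) (Complex.ofReal_im k).ge
  rw [Complex.ofReal_im, Real.exp_zero, mul_one] at htransform
  rw [norm_mul, norm_elem, sq_re, Complex.ofReal_im, Complex.ofReal_re, mul_comm]
  refine mul_le_mul htransform (Real.exp_le_exp.2 ?_) (Real.exp_pos _).le
    ((norm_nonneg _).trans htransform)
  nlinarith [mul_le_mul_of_nonneg_right hσ (sq_nonneg k)]

theorem continuous_elem_mul_spaceTransform (hf : IntervalIntegrable f volume 0 1) (x σ : ℝ) :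
    Continuous fun k : ℝ => elem x σ k * spaceTransform f (-I * k) :=
  ((differentiable_elem x σ).continuous.comp Complex.continuous_ofReal).mul
    ((differentiable_spaceTransform hf).continuous.comp (by fun_prop))

theorem integrable_elem_mul_spaceTransform (hf : IntervalIntegrable f volume 0 1) (hσ : 0 < σ)
    (x : ℝ) : Integrable fun k : ℝ => elem x σ k * spaceTransform f (-I * k) :=
  ((integrable_exp_neg_mul_sq hσ).const_mul _).mono'
    (continuous_elem_mul_spaceTransform hf x σ).aestronglyMeasurable
    (.of_forall (norm_elem_mul_spaceTransform_le hf le_rfl x))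

theorem tendsto_integral_elem_add_mul_spaceTransform (hf : IntervalIntegrable f volume 0 1)
    (hσ : 0 < σ) (x : ℝ) :
    Tendsto (fun s : ℝ => ∫ k : ℝ, elem x (σ + s) k * spaceTransform f (-I * k)) (𝓝[>] 0)
      (𝓝 (∫ k : ℝ, elem x σ k * spaceTransform f (-I * k))) := by
  refine tendsto_integral_filter_of_dominated_convergence _
    (.of_forall fun s => (continuous_elem_mul_spaceTransform hf x _).aestronglyMeasurable) ?_
    ((integrable_exp_neg_mul_sq hσ).const_mul (∫ y in (0 : ℝ)..1, |f y|))
    (.of_forall fun k => tendsto_nhdsWithin_of_tendsto_nhds ?_)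
  · filter_upwards [self_mem_nhdsWithin] with s hs
    exact .of_forall
      (norm_elem_mul_spaceTransform_le hf (le_add_of_nonneg_right (le_of_lt hs)) x)
  · refine Continuous.tendsto' ?_ _ _ (by rw [add_zero])
    unfold elem
    fun_prop

end RealLine

section FutureSlices

variable {C X t T ε : ℝ} {N : ℂ → ℂ}

/-- The factor `Δ` absorbs the exponential growth, and `T ≥ t` makes the Gaussian factors
`e^{k²(T - t)}` bounded on `D₊`. -/
theorem integralBoundaryPlus_elem_div_Δ_mul_eq_zero (hε : 0 < ε) (hX : 0 < X) (hT : t ≤ T)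
    (hN : Differentiable ℂ N)
    (hNb : ∀ k : ℂ, 0 ≤ k.im →
      ‖N k‖ ≤ C * ((1 + ‖k‖) * Real.exp k.im) * Real.exp (T * (k ^ 2).re)) :
    IntegrableBoundaryPlus ε (fun k => elem X t k / Δ k * N k) ∧
      integralBoundaryPlus ε (fun k => elem X t k / Δ k * N k) = 0 := by
  obtain ⟨c, hc, hΔ⟩ := exists_le_norm_Δ hε
  have hC : 0 ≤ C := by
    have hzero := (norm_nonneg _).trans (hNb 0 le_rfl)
    simpa using hzero
  refine integralBoundaryPlus_eq_zero_of_decay (C := C / c) hε hX (fun k hk =>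
    (((differentiable_elem X t) k).div (differentiable_Δ k) (Δ_ne_zero hk.ne')).mul (hN k))
    fun k hk hre => ?_
  have hquotient : ‖N k‖ / ‖Δ k‖ ≤ C / c * Real.exp (T * (k ^ 2).re) := by
    rw [div_le_iff₀ ((by positivity : 0 < c * _).trans_le (hΔ k hk))]
    calc ‖N k‖ ≤ C * ((1 + ‖k‖) * Real.exp k.im) * Real.exp (T * (k ^ 2).re) :=
          hNb k (hε.le.trans hk)
      _ = C / c * Real.exp (T * (k ^ 2).re) * (c * ((1 + ‖k‖) * Real.exp k.im)) := by
          field_simp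
      _ ≤ C / c * Real.exp (T * (k ^ 2).re) * ‖Δ k‖ := by gcongr; exact hΔ k hk
  calc ‖elem X t k / Δ k * N k‖ = Real.exp (-X * k.im - t * (k ^ 2).re) * (‖N k‖ / ‖Δ k‖) := by
        rw [norm_mul, norm_div, norm_elem, div_mul_eq_mul_div, mul_div_assoc]
    _ ≤ Real.exp (-X * k.im - t * (k ^ 2).re) * (C / c * Real.exp (T * (k ^ 2).re)) := by gcongr
    _ = C / c * Real.exp (-X * k.im + (T - t) * (k ^ 2).re) := by
        rw [mul_left_comm, ← Real.exp_add]
        ring_nf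
    _ ≤ C / c * Real.exp (-X * k.im) := by
        gcongr
        linarith [mul_nonpos_of_nonneg_of_nonpos (sub_nonneg.2 hT) hre]

end FutureSlices

section FluxGrowth

variable {f : ℝ → ℝ} {t C C' : ℝ} {φ P Q : ℂ → ℂ}

theorem differentiable_timeTransform_sq (hf : IntervalIntegrable f volume 0 t) :
    Differentiable ℂ fun k => timeTransform f (k ^ 2) t :=
  (differentiable_timeTransform hf).comp (differentiable_id.pow 2)

namespace HasFluxGrowth

theorem mul_of_norm_le (hφ : ∀ k : ℂ, 0 ≤ k.im → ‖φ k‖ ≤ 1 + ‖k‖)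
    (hP : ∀ k : ℂ, 0 ≤ k.im → ‖P k‖ ≤ C * (1 + Real.exp (t * (k ^ 2).re))) :
    HasFluxGrowth t C fun k => φ k * P k := fun k hk => by
  rw [norm_mul, mul_left_comm]
  exact mul_le_mul (hφ k hk) (hP k hk) (norm_nonneg _) (by positivity)

theorem of_norm_le (hP : ∀ k : ℂ, 0 ≤ k.im → ‖P k‖ ≤ C * (1 + Real.exp (t * (k ^ 2).re))) :
    HasFluxGrowth t C P := by
  simpa only [Pi.one_apply, one_mul] using
    mul_of_norm_le (φ := 1) (fun k _ => by simp) hP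

theorem add (hP : HasFluxGrowth t C P) (hQ : HasFluxGrowth t C' Q) :
    HasFluxGrowth t (C + C') fun k => P k + Q k := fun k hk => by
  rw [add_mul]
  exact norm_add_le_of_le (hP k hk) (hQ k hk)

theorem sub (hP : HasFluxGrowth t C P) (hQ : HasFluxGrowth t C' Q) :
    HasFluxGrowth t (C + C') fun k => P k - Q k := fun k hk => by
  rw [add_mul]
  exact norm_sub_le_of_le (hP k hk) (hQ k hk)

end HasFluxGrowth
end FluxGrowth

namespace IsClassicalSolution

variable {u₀ j : ℝ → ℝ} {u : ℝ → ℝ → ℝ} {x t s T ε : ℝ}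

theorem differentiable_spaceTransform_slice (hu : IsClassicalSolution u₀ j u) (hT : 0 ≤ T)
    (z : ℂ) : Differentiable ℂ fun k => spaceTransform (fun y => u y T) (z * k) :=
  (differentiable_spaceTransform (hu.intervalIntegrable_slice hT)).comp (by fun_prop)

theorem differentiable_ν₀Future (hu : IsClassicalSolution u₀ j u) (hT : 0 ≤ T) :
    Differentiable ℂ (ν₀Future u T) :=
  (((differentiable_h.mul (hu.differentiable_spaceTransform_slice hT I)).sub
    ((differentiable_h.comp differentiable_neg).mul
      (hu.differentiable_spaceTransform_slice hT (-I)))).neg).mul (by fun_prop)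

theorem differentiable_ν₁Future (hu : IsClassicalSolution u₀ j u) (hT : 0 ≤ T) :
    Differentiable ℂ (ν₁Future u T) :=
  (((hu.differentiable_spaceTransform_slice hT I).sub
    (hu.differentiable_spaceTransform_slice hT (-I))).neg).mul (by fun_prop)

theorem norm_ν₀Future_le (hu : IsClassicalSolution u₀ j u) (hT : 0 ≤ T) {k : ℂ}
    (hk : 0 ≤ k.im) :
    ‖ν₀Future u T k‖ ≤ 2 * (∫ y in (0 : ℝ)..1, |u y T|) * ((1 + ‖k‖) * Real.exp k.im)
      * Real.exp (T * (k ^ 2).re) := by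
  have hf := hu.intervalIntegrable_slice hT
  rw [ν₀Future, norm_mul, norm_neg, norm_exp_sq_mul]
  gcongr
  calc _ ≤ ‖h k‖ * ‖spaceTransform (fun y => u y T) (I * k)‖
        + ‖h (-k)‖ * ‖spaceTransform (fun y => u y T) (-I * k)‖ := by
        simpa only [norm_mul] using norm_sub_le (h k * _) (h (-k) * _)
    _ ≤ Real.exp k.im * (1 + ‖k‖) * (∫ y in (0 : ℝ)..1, |u y T|)
        + (1 + ‖k‖) * ((∫ y in (0 : ℝ)..1, |u y T|) * Real.exp k.im) := by
        gcongr
        · exact norm_h_le k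
        · exact norm_spaceTransform_I_mul_le hf hk
        · exact norm_h_neg_le hk
        · exact norm_spaceTransform_neg_I_mul_le hf hk
    _ = _ := by ring

theorem norm_one_sub_mul_ν₁Future_le (hu : IsClassicalSolution u₀ j u) (hT : 0 ≤ T) {k : ℂ}
    (hk : 0 ≤ k.im) :
    ‖(1 - I * k) * ν₁Future u T k‖ ≤ 2 * (∫ y in (0 : ℝ)..1, |u y T|)
      * ((1 + ‖k‖) * Real.exp k.im) * Real.exp (T * (k ^ 2).re) := by
  have hf := hu.intervalIntegrable_slice hT
  rw [ν₁Future, ← mul_assoc, norm_mul, norm_mul, norm_neg, norm_exp_sq_mul]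
  refine mul_le_mul_of_nonneg_right ?_ (Real.exp_pos _).le
  calc _ ≤ (1 + ‖k‖) * ((∫ y in (0 : ℝ)..1, |u y T|)
        + (∫ y in (0 : ℝ)..1, |u y T|) * Real.exp k.im) := by
        gcongr
        · exact norm_one_sub_I_mul_le k
        · exact norm_sub_le_of_le (norm_spaceTransform_I_mul_le hf hk)
            (norm_spaceTransform_neg_I_mul_le hf hk)
    _ ≤ (1 + ‖k‖) * ((∫ y in (0 : ℝ)..1, |u y T|) * Real.exp k.im
        + (∫ y in (0 : ℝ)..1, |u y T|) * Real.exp k.im) := by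
        gcongr
        exact le_mul_of_one_le_right (integral_abs_nonneg zero_le_one _) (Real.one_le_exp hk)
    _ = 2 * (∫ y in (0 : ℝ)..1, |u y T|) * ((1 + ‖k‖) * Real.exp k.im) := by ring

theorem integralBoundaryPlus_ν₀Future_eq_zero (hu : IsClassicalSolution u₀ j u) (hx : 0 < x)
    (ht : 0 ≤ t) (hT : t ≤ T) (hε : 0 < ε) :
    IntegrableBoundaryPlus ε (fun k => elem x t k / Δ k * ν₀Future u T k) ∧
      integralBoundaryPlus ε (fun k => elem x t k / Δ k * ν₀Future u T k) = 0 :=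
  integralBoundaryPlus_elem_div_Δ_mul_eq_zero hε hx hT (hu.differentiable_ν₀Future (ht.trans hT))
    fun _ => hu.norm_ν₀Future_le (ht.trans hT)

theorem integralBoundaryMinus_ν₁Future_eq_zero (hu : IsClassicalSolution u₀ j u) (hx : x < 1)
    (ht : 0 ≤ t) (hT : t ≤ T) (hε : 0 < ε) :
    IntegrableBoundaryMinus ε (fun k => elem x t k / Δ k * (h k * ν₁Future u T k)) ∧
      integralBoundaryMinus ε (fun k => elem x t k / Δ k * (h k * ν₁Future u T k)) = 0 := by
  have hreflect : ∀ k, elem x t (-k) / Δ (-k) * (h (-k) * ν₁Future u T (-k)) =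
      elem (1 - x) t k / Δ k * ((1 - I * k) * ν₁Future u T k) := fun k => by
    rw [elem_neg_eq, Δ_neg, ν₁Future_neg, h_neg]
    linear_combination (elem (1 - x) t k / Δ k * ((1 - I * k) * ν₁Future u T k)) *
      exp_neg_I_mul_mul_exp_I_mul k
  simp only [integrableBoundaryMinus_iff, integralBoundaryMinus_eq, neg_eq_zero, hreflect]
  exact integralBoundaryPlus_elem_div_Δ_mul_eq_zero hε (sub_pos.2 hx) hT
    (Differentiable.mul (by fun_prop) (hu.differentiable_ν₁Future (ht.trans hT)))
    fun _ => hu.norm_one_sub_mul_ν₁Future_le (ht.trans hT)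

theorem differentiable_leftFlux (hu : IsClassicalSolution u₀ j u) (ht : 0 ≤ t)
    (hj : IntervalIntegrable j volume 0 t) : Differentiable ℂ (leftFlux u₀ j u t) :=
  ((((differentiable_spaceTransform hu.intervalIntegrable_initial).comp (by fun_prop)).add
    (Differentiable.mul (by fun_prop) (differentiable_timeTransform_sq hj))).add
    ((differentiable_h.comp differentiable_neg).mul
      (differentiable_timeTransform_sq (hu.intervalIntegrable_boundary le_rfl ht)))).sub
    (Differentiable.mul (by fun_prop) (hu.differentiable_spaceTransform_slice ht I))

theorem differentiable_rightFlux (hu : IsClassicalSolution u₀ j u) (ht : 0 ≤ t)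
    (hj : IntervalIntegrable j volume 0 t) : Differentiable ℂ (rightFlux j u t) :=
  (differentiable_timeTransform_sq hj).add (Differentiable.mul (by fun_prop)
    (differentiable_timeTransform_sq (hu.intervalIntegrable_boundary le_rfl ht)))

theorem exists_hasFluxGrowth_rightFlux (hu : IsClassicalSolution u₀ j u) (ht : 0 ≤ t)
    (hj : IntervalIntegrable j volume 0 t) : ∃ C, HasFluxGrowth t C (rightFlux j u t) :=
  ⟨_, (HasFluxGrowth.of_norm_le fun k _ => norm_timeTransform_le_one_add_exp ht hj (k ^ 2)).add
    (HasFluxGrowth.mul_of_norm_le (fun k _ => norm_one_sub_I_mul_le k) fun k _ =>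
      norm_timeTransform_le_one_add_exp ht (hu.intervalIntegrable_boundary le_rfl ht) (k ^ 2))⟩

theorem exists_hasFluxGrowth_leftFlux (hu : IsClassicalSolution u₀ j u) (ht : 0 ≤ t)
    (hj : IntervalIntegrable j volume 0 t) : ∃ C, HasFluxGrowth t C (leftFlux u₀ j u t) := by
  have hinitial : HasFluxGrowth t (∫ y in (0 : ℝ)..1, |u₀ y|) fun k =>
      spaceTransform u₀ (I * k) := .of_norm_le fun k hk => by
    refine (norm_spaceTransform_I_mul_le hu.intervalIntegrable_initial hk).trans
      (le_mul_of_one_le_right (integral_abs_nonneg zero_le_one u₀) ?_)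
    exact le_add_of_nonneg_right (Real.exp_pos _).le
  have hforcing : HasFluxGrowth t (∫ τ in (0 : ℝ)..t, |j τ|) fun k =>
      Complex.exp (I * k) * timeTransform j (k ^ 2) t := .mul_of_norm_le (fun k hk => by
    rw [norm_exp_I_mul]
    exact le_add_of_le_of_nonneg (Real.exp_le_one_iff.2 (neg_nonpos.2 hk)) (norm_nonneg k))
    fun k _ => norm_timeTransform_le_one_add_exp ht hj (k ^ 2)
  have hboundary : HasFluxGrowth t (∫ τ in (0 : ℝ)..t, |u 1 τ|) fun k =>
      h (-k) * timeTransform (u 1) (k ^ 2) t := .mul_of_norm_le (fun k hk => norm_h_neg_le hk)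
    fun k _ => norm_timeTransform_le_one_add_exp ht
      (hu.intervalIntegrable_boundary le_rfl ht) (k ^ 2)
  have hslice : HasFluxGrowth t (∫ y in (0 : ℝ)..1, |u y t|) fun k =>
      Complex.exp (k ^ 2 * t) * spaceTransform (fun x => u x t) (I * k) :=
    .of_norm_le fun k hk => by
      rw [norm_mul, norm_exp_sq_mul, mul_comm]
      exact mul_le_mul (norm_spaceTransform_I_mul_le (hu.intervalIntegrable_slice ht) hk)
        (le_add_of_nonneg_left zero_le_one) (Real.exp_pos _).le
        (integral_abs_nonneg zero_le_one _)
  exact ⟨_, ((hinitial.add hforcing).add hboundary).sub hslice⟩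

theorem integralBoundaryPlus_μ₀_eq (hu : IsClassicalSolution u₀ j u) (ht : 0 < t)
    (hj : IntervalIntegrable j volume 0 t) (hε : 0 < ε) (hx : 2 * ε * t < x) :
    IntegrableBoundaryPlus ε (fun k => elem x t k / Δ k * μ₀ u₀ j t k) ∧
      integralBoundaryPlus ε (fun k => elem x t k / Δ k * μ₀ u₀ j t k) =
        integralBoundaryPlus ε fun k => elem x t k * leftFlux u₀ j u t k := by
  obtain ⟨C, hC⟩ := hu.exists_hasFluxGrowth_leftFlux ht.le hj
  have hleft := hC.integrableBoundaryPlus_elem_mul (hu.differentiable_leftFlux ht.le hj) ht.le hε hx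
  have hx₀ : 0 < x := lt_trans (by positivity) hx
  obtain ⟨hν, hν₀⟩ := hu.integralBoundaryPlus_ν₀Future_eq_zero hx₀ ht.le le_rfl hε
  have heq : EqOn (fun k => elem x t k / Δ k * μ₀ u₀ j t k) (fun k =>
      elem x t k * leftFlux u₀ j u t k - elem x t k / Δ k * ν₀Future u t k) {k | 0 < k.im} :=
    fun k hk => hu.elem_div_Δ_mul_μ₀ ht hj x (ne_of_gt hk)
  rw [integrableBoundaryPlus_congr hε heq, integralBoundaryPlus_congr hε heq,
    integralBoundaryPlus_sub hleft hν, hν₀, sub_zero]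
  exact ⟨integrableBoundaryPlus_sub hleft hν, rfl⟩

theorem integralBoundaryMinus_μ₁_eq (hu : IsClassicalSolution u₀ j u) (ht : 0 < t)
    (hj : IntervalIntegrable j volume 0 t) (hε : 0 < ε) (hx : 2 * ε * t < 1 - x) :
    IntegrableBoundaryMinus ε (fun k => elem x t k / Δ k * μ₁ u₀ j t k) ∧
      integralBoundaryMinus ε (fun k => elem x t k / Δ k * μ₁ u₀ j t k) =
        -integralBoundaryPlus ε fun k => elem (1 - x) t k * rightFlux j u t k := by
  obtain ⟨C, hC⟩ := hu.exists_hasFluxGrowth_rightFlux ht.le hj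
  have hright :=
    hC.integrableBoundaryPlus_elem_mul (hu.differentiable_rightFlux ht.le hj) ht.le hε hx
  have hx₁ : x < 1 := sub_pos.1 (lt_trans (by positivity) hx)
  obtain ⟨hν, hν₀⟩ := hu.integralBoundaryMinus_ν₁Future_eq_zero hx₁ ht.le le_rfl hε
  rw [integrableBoundaryMinus_iff] at hν ⊢
  rw [integralBoundaryMinus_eq, neg_eq_zero] at hν₀
  have heq : EqOn (fun k => elem x t (-k) / Δ (-k) * μ₁ u₀ j t (-k)) (fun k =>
      elem (1 - x) t k * rightFlux j u t k
        - elem x t (-k) / Δ (-k) * (h (-k) * ν₁Future u t (-k))) {k | 0 < k.im} :=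
    fun k hk => hu.elem_div_Δ_mul_μ₁_neg ht hj x (ne_of_gt hk)
  rw [integralBoundaryMinus_eq, integrableBoundaryPlus_congr hε heq,
    integralBoundaryPlus_congr hε heq, integralBoundaryPlus_sub hright hν, hν₀, sub_zero]
  exact ⟨integrableBoundaryPlus_sub hright hν, rfl⟩

theorem integral_elem_mul_spaceTransform_slice (hu : IsClassicalSolution u₀ j u) (ht : 0 < t)
    (hj : IntervalIntegrable j volume 0 t) (hx : x ∈ Icc (0 : ℝ) 1) (hs : 0 < s) :
    ∫ k : ℝ, elem x s k * spaceTransform (fun y => u y t) (-I * k) =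
      (∫ k : ℝ, elem x (t + s) k * spaceTransform u₀ (-I * k))
        - (∫ k : ℝ, elem x (t + s) k * leftFlux u₀ j u t k)
        + ∫ k : ℝ, elem (1 - x) (t + s) k * rightFlux j u t k := by
  obtain ⟨_, hL⟩ := hu.exists_hasFluxGrowth_leftFlux ht.le hj
  obtain ⟨_, hR⟩ := hu.exists_hasFluxGrowth_rightFlux ht.le hj
  have hinitial := integrable_elem_mul_spaceTransform hu.intervalIntegrable_initial
    (add_pos ht hs) x
  have hleft := hL.integrable_elem_mul (hu.differentiable_leftFlux ht.le hj) ht.le hs hx.1 le_rfl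
  have hright := hR.integrable_elem_mul (hu.differentiable_rightFlux ht.le hj) ht.le hs
    (sub_nonneg.2 hx.2) le_rfl
  simp only [Complex.ofReal_zero, zero_mul, add_zero] at hleft hright
  rw [← integral_neg_eq_self fun k : ℝ => elem (1 - x) (t + s) k * rightFlux j u t k,
    ← integral_sub hinitial hleft]
  refine .trans ?_ (integral_add (hinitial.sub hleft) hright.comp_neg)
  refine integral_congr_ae (.of_forall fun k => ?_)
  simp only [hu.elem_mul_spaceTransform_eq ht hj, Complex.ofReal_neg]

theorem two_pi_mul_solution_eq (hu : IsClassicalSolution u₀ j u) (ht : 0 < t)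
    (hj : IntervalIntegrable j volume 0 t) (hx : x ∈ Ioo (0 : ℝ) 1) (hε : 0 < ε)
    (hεx : 2 * ε * t < x) (hεx' : 2 * ε * t < 1 - x) :
    2 * Real.pi * (u x t : ℂ) =
      (∫ k : ℝ, elem x t k * spaceTransform u₀ (-I * k))
        - (integralBoundaryPlus ε fun k => elem x t k * leftFlux u₀ j u t k)
        + integralBoundaryPlus ε fun k => elem (1 - x) t k * rightFlux j u t k := by
  obtain ⟨_, hL⟩ := hu.exists_hasFluxGrowth_leftFlux ht.le hj
  obtain ⟨_, hR⟩ := hu.exists_hasFluxGrowth_rightFlux ht.le hj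
  have hslice := tendsto_integral_elem_mul_spaceTransform (hu.intervalIntegrable_slice ht.le) hx
    ((hu.continuousOn_slice ht.le).continuousAt (Icc_mem_nhds hx.1 hx.2))
  have hlimit := ((tendsto_integral_elem_add_mul_spaceTransform hu.intervalIntegrable_initial
    ht x).sub
      (hL.tendsto_integral_elem_mul (hu.differentiable_leftFlux ht.le hj) ht.le hε hεx)).add
      (hR.tendsto_integral_elem_mul (hu.differentiable_rightFlux ht.le hj) ht.le hε hεx')
  refine tendsto_nhds_unique hslice (hlimit.congr' ?_)
  filter_upwards [self_mem_nhdsWithin] with s hs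
  exact (hu.integral_elem_mul_spaceTransform_slice ht hj (Ioo_subset_Icc_self hx) hs).symm

end IsClassicalSolution

end RobinHeat

theorem mainTheorem1 (u₀ j : ℝ → ℝ) (u : ℝ → ℝ → ℝ)
    (hu : RobinHeat.IsClassicalSolution u₀ j u)
    (x t ε : ℝ) (hx : x ∈ Set.Ioo (0 : ℝ) 1) (ht : 0 < t)
    (hj : IntervalIntegrable j MeasureTheory.volume 0 t)
    (hε : 0 < ε) (hεxt : 2 * ε * t < min x (1 - x)) :
    -- the denominator does not vanish on the contours
    (∀ k : ℂ, k.im ≠ 0 → RobinHeat.Δ k ≠ 0) ∧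
    -- the three integrals converge absolutely
    MeasureTheory.Integrable (fun k : ℝ =>
      RobinHeat.elem x t k * RobinHeat.spaceTransform u₀ (-Complex.I * k)) ∧
    RobinHeat.IntegrableBoundaryPlus ε (fun k =>
      RobinHeat.elem x t k / RobinHeat.Δ k * RobinHeat.μ₀ u₀ j t k) ∧
    RobinHeat.IntegrableBoundaryMinus ε (fun k =>
      RobinHeat.elem x t k / RobinHeat.Δ k * RobinHeat.μ₁ u₀ j t k) ∧
    -- the representation of the solution
    (u x t : ℂ) = 1 / (2 * Real.pi) *
      ((∫ k : ℝ, RobinHeat.elem x t k * RobinHeat.spaceTransform u₀ (-Complex.I * k))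
        - RobinHeat.integralBoundaryPlus ε (fun k =>
            RobinHeat.elem x t k / RobinHeat.Δ k * RobinHeat.μ₀ u₀ j t k)
        - RobinHeat.integralBoundaryMinus ε (fun k =>
            RobinHeat.elem x t k / RobinHeat.Δ k * RobinHeat.μ₁ u₀ j t k)) ∧
    -- the data on a future time slice do not contribute
    (∀ T : ℝ, t ≤ T →
      RobinHeat.IntegrableBoundaryPlus ε (fun k =>
        RobinHeat.elem x t k / RobinHeat.Δ k * RobinHeat.ν₀Future u T k) ∧
      RobinHeat.integralBoundaryPlus ε (fun k =>
        RobinHeat.elem x t k / RobinHeat.Δ k * RobinHeat.ν₀Future u T k) = 0 ∧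
      RobinHeat.IntegrableBoundaryMinus ε (fun k =>
        RobinHeat.elem x t k / RobinHeat.Δ k * (RobinHeat.h k * RobinHeat.ν₁Future u T k)) ∧
      RobinHeat.integralBoundaryMinus ε (fun k =>
        RobinHeat.elem x t k / RobinHeat.Δ k * (RobinHeat.h k * RobinHeat.ν₁Future u T k)) = 0) := by
  have hεx : 2 * ε * t < x := hεxt.trans_le (min_le_left _ _)
  have hεx' : 2 * ε * t < 1 - x := hεxt.trans_le (min_le_right _ _)
  obtain ⟨hplus, hplus_eq⟩ := hu.integralBoundaryPlus_μ₀_eq ht hj hε hεx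
  obtain ⟨hminus, hminus_eq⟩ := hu.integralBoundaryMinus_μ₁_eq ht hj hε hεx'
  have hinitial :=
    RobinHeat.integrable_elem_mul_spaceTransform hu.intervalIntegrable_initial ht x
  refine ⟨fun k hk => RobinHeat.Δ_ne_zero hk, hinitial, hplus, hminus, ?_, fun T hT => ?_⟩
  · have h2π : (2 * Real.pi : ℂ) ≠ 0 := by exact_mod_cast Real.two_pi_pos.ne'
    rw [one_div, eq_inv_mul_iff_mul_eq₀ h2π, hplus_eq, hminus_eq, sub_neg_eq_add,
      hu.two_pi_mul_solution_eq ht hj hx hε hεx hεx']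
  · obtain ⟨hν₀, hν₀_zero⟩ := hu.integralBoundaryPlus_ν₀Future_eq_zero hx.1 ht.le hT hε
    obtain ⟨hν₁, hν₁_zero⟩ := hu.integralBoundaryMinus_ν₁Future_eq_zero hx.2 ht.le hT hε
    exact ⟨hν₀, hν₀_zero, hν₁, hν₁_zero⟩
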